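/- **Theorem 8 (minimax lower bounds for transfer learning of binary Gaussian mixtures).** Fix constants $M_\mu>0$, $c_w\in(0,1/2)$ and $c_\Sigma>1$. For $p\ge 1$ let $\overline\Theta$ be the set of all $\overline\theta=(w,\mu_1,\mu_2,\Sigma)$ with $w\in(c_w,1-c_w)$, $\mu_1,\mu_2\in\mathbb R^p$, $\|\mu_1\|_2\vee\|\mu_2\|_2\le M_\mu$, and $\Sigma\in\mathbb R^{p\times p}$ symmetric with all eigenvalues in $[c_\Sigma^{-1},c_\Sigma]$. Put $\beta=\Sigma^{-1}(\mu_1-\mu_2)$ and $\theta=(w,\mu_1,\mu_2,\beta)$, and let $P_{\overline\theta}=(1-w)\,\mathcal N(\mu_1,\Sigma)+w\,\mathcal N(\mu_2,\Sigma)$. Define $$d(\theta,\theta')=|w-w'|\vee\|\mu_1-\mu_1'\|_2\vee\|\mu_2-\mu_2'\|_2\vee\|\beta-\beta'\|_2 .$$ There are a target sample of size $n_0$ and $K$ source samples of sizes $n_1,\dots,n_K\ge 1$ in $\mathbb R^p$. For $S\subseteq\{1,\dots,K\}$ let $\overline\Theta_S^{(T)}(h_w,h_\mu,h_\beta)$ be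 the set of families $(\overline\theta^{(k)})_{k\in\{0\}\cup S}$ in $\overline\Theta$ with $|w^{(k)}-w^{(0)}|\le h_w$, $\|\mu_1^{(k)}-\mu_1^{(0)}\|_2\vee\|\mu_2^{(k)}-\mu_2^{(0)}\|_2\le h_\mu$ and $\|\beta^{(k)}-\beta^{(0)}\|_2\le h_\beta$ for all $k\in S$. Given such a family and a probability measure $\mathbb Q_S$ on the data of the sources outside $S$, let $\mathbb P$ be the law of all the data under which the observations of tasks $k\in\{0\}\cup S$ are independent with law $P_{\overline\theta^{(k)}}$, and the data of the sources outside $S$ have joint law $\mathbb Q_S$ and are independent of the rest. Write $n_S=\sum_{k\in S}n_k$ and $\epsilon=(K-s)/s$. For all constants $c>0$ and $C>0$ there is a constant $C_1>0$, depending only on $M_\mu,c_w,c_\Sigma,c,C$, such that for all $p\ge1$, $1\le s\le K$ with $\epsilon<c$, all $n_1,\dots,n_K\ge1$, all $n_0\ge Cp$ and all $h_w,h_\mu,h_\beta\ge 0$: $$\inf_{\widehat\theta^{(0)}}\ \sup_{S:\,|S|\ge s}\ \sup_{\substack{(\overline\theta^{(k)*})\in\overline\Theta_S^{(T)}(h_w,h_\mu,h_\beta)\\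 \mathbb Q_S}}\mathbb P\Bigg(d(\widehat\theta^{(0)},\theta^{(0)*})\ge C_1\bigg[\sqrt{\tfrac{p}{n_S+n_0}}+\min\Big\{\tfrac{\epsilon}{\sqrt{\max_{1\le k\le K}n_k}},\sqrt{\tfrac1{n_0}}\Big\}+\min\Big\{h_w,\sqrt{\tfrac1{n_0}}\Big\}+\min\Big\{h_\mu,\sqrt{\tfrac p{n_0}}\Big\}+\min\Big\{h_\beta,\sqrt{\tfrac p{n_0}}\Big\}\bigg]\Bigg)\ge\frac1{10},$$ $$\inf_{\widehat\Sigma^{(0)}}\ \sup_{S:\,|S|\ge s}\ \sup_{\substack{(\overline\theta^{(k)*})\in\overline\Theta_S^{(T)}(h_w,h_\mu,h_\beta)\\ \mathbb Q_S}}\mathbb P\Bigg(\|\widehat\Sigma^{(0)}-\Sigma^{(0)*}\|_2\ge C_1\sqrt{\tfrac p{n_0}}\Bigg)\ge\frac1{10}.$$ The infima are over all measurable functions of the whole data set (target and sources) with values in $\mathbb R\times(\mathbb R^p)^3$ and $\mathbb R^{p\times p}$ respectively, which do not depend on $S$; $\|\cdot\|_2$ of a matrix is the spectral norm. -/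

import Mathlib

open MeasureTheory ProbabilityTheory
open scoped ENNReal

noncomputable section

/-- A full parameter `(w, μ₁, μ₂, Σ)` of a binary Gaussian mixture on `ℝᵖ`. -/
structure GMMParam (p : ℕ) where
  /-- the mixture proportion of the second component -/
  w : ℝ
  /-- the mean of the first component -/
  mu1 : EuclideanSpace ℝ (Fin p)
  /-- the mean of the second component -/
  mu2 : EuclideanSpace ℝ (Fin p)
  /-- the common covariance matrix -/
  cov : Matrix (Fin p) (Fin p) ℝ

/-- The reduced parameters `(w, μ₁, μ₂, β)`. -/
abbrev GMMCoef (p : ℕ) : Type :=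
  ℝ × EuclideanSpace ℝ (Fin p) × EuclideanSpace ℝ (Fin p) × EuclideanSpace ℝ (Fin p)

/-- The discriminant coefficient `β = Σ⁻¹ (μ₁ - μ₂)`. -/
def GMMParam.beta {p : ℕ} (θ : GMMParam p) : EuclideanSpace ℝ (Fin p) :=
  WithLp.toLp 2 (θ.cov⁻¹.mulVec (WithLp.ofLp (θ.mu1 - θ.mu2)))

/-- The reduced parameter `(w, μ₁, μ₂, β)` of a full parameter. -/
def GMMParam.coef {p : ℕ} (θ : GMMParam p) : GMMCoef p :=
  (θ.w, θ.mu1, θ.mu2, θ.beta)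

/-- The parameter space of a single mixture. -/
def IsGMMParam {p : ℕ} (Mμ cw cS : ℝ) (θ : GMMParam p) : Prop :=
  max ‖θ.mu1‖ ‖θ.mu2‖ ≤ Mμ ∧ θ.w ∈ Set.Ioo cw (1 - cw) ∧
    θ.cov.IsHermitian ∧ spectrum ℝ θ.cov ⊆ Set.Icc cS⁻¹ cS

/-- The law of one observation `z`: the label is `1` with probability `1 - w` and `2` with
probability `w`, and `z` is `N(μⱼ, Σ)` given that the label is `j`. -/
def GMMParam.law {p : ℕ} (θ : GMMParam p) : Measure (EuclideanSpace ℝ (Fin p)) :=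
  ENNReal.ofReal (1 - θ.w) • multivariateGaussian θ.mu1 θ.cov +
    ENNReal.ofReal θ.w • multivariateGaussian θ.mu2 θ.cov

/-- The distance `|w - w'| ∨ ‖μ₁ - μ₁'‖ ∨ ‖μ₂ - μ₂'‖ ∨ ‖β - β'‖`. -/
def coefDist {p : ℕ} (a b : GMMCoef p) : ℝ :=
  max |a.1 - b.1| (max ‖a.2.1 - b.2.1‖ (max ‖a.2.2.1 - b.2.2.1‖ ‖a.2.2.2 - b.2.2.2‖))

/-- The spectral norm of a square matrix. -/
def spectralNorm2 {p : ℕ} (A : Matrix (Fin p) (Fin p) ℝ) : ℝ :=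
  ‖Matrix.toEuclideanCLM (n := Fin p) (𝕜 := ℝ) A‖

/-- The joint parameter space of the target (`θ0`) and of the sources in `S`; the target
parameters are the center. -/
def InTransferSpace {p K : ℕ} (Mμ cw cS hw hμ hβ : ℝ) {S : Finset (Fin K)}
    (θ0 : GMMParam p) (θ : {k // k ∈ S} → GMMParam p) : Prop :=
  IsGMMParam Mμ cw cS θ0 ∧ ∀ k,
    IsGMMParam Mμ cw cS (θ k) ∧
    |(θ k).w - θ0.w| ≤ hw ∧
    max ‖(θ k).mu1 - θ0.mu1‖ ‖(θ k).mu2 - θ0.mu2‖ ≤ hμ ∧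
    ‖(θ k).beta - θ0.beta‖ ≤ hβ

/-- The whole data set: the target sample of size `n0`, and for each source `k` a sample of
size `n k`. -/
abbrev TransferData (p K n0 : ℕ) (n : Fin K → ℕ) : Type :=
  (Fin n0 → EuclideanSpace ℝ (Fin p)) × ((k : Fin K) → Fin (n k) → EuclideanSpace ℝ (Fin p))

/-- The data of the sources outside `S`. -/
abbrev OutlierData (p : ℕ) {K : ℕ} (n : Fin K → ℕ) (S : Finset (Fin K)) : Type :=
  (k : {k : Fin K // ¬ k ∈ S}) → Fin (n k) → EuclideanSpace ℝ (Fin p)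

/-- The law of the sources' data: the observations of the sources in `S` are independent, those
of source `k ∈ S` with the mixture law of `θ k`, and the data of all the sources outside `S` have
the joint law `Q` and are independent of the data of the sources in `S`. -/
def sourceLaw {p K : ℕ} (n : Fin K → ℕ) (S : Finset (Fin K))
    (θ : {k // k ∈ S} → GMMParam p) (Q : ProbabilityMeasure (OutlierData p n S)) :
    Measure ((k : Fin K) → Fin (n k) → EuclideanSpace ℝ (Fin p)) :=
  Measure.map
    (MeasurableEquiv.piEquivPiSubtypeProd
      (fun k : Fin K => Fin (n k) → EuclideanSpace ℝ (Fin p)) (fun k => k ∈ S)).symm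
    ((Measure.pi fun k : {k : Fin K // k ∈ S} =>
        Measure.pi fun _ : Fin (n k) => (θ k).law).prod
      (Q : Measure (OutlierData p n S)))

/-- The law of the whole data set: the target sample is i.i.d. with the mixture law of `θ0` and
independent of the sources' data. -/
def transferLaw {p K : ℕ} (n0 : ℕ) (n : Fin K → ℕ) (S : Finset (Fin K)) (θ0 : GMMParam p)
    (θ : {k // k ∈ S} → GMMParam p) (Q : ProbabilityMeasure (OutlierData p n S)) :
    Measure (TransferData p K n0 n) :=
  (Measure.pi fun _ : Fin n0 => θ0.law).prod (sourceLaw n S θ Q)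

/-- The outlier proportion `ε = (K - s) / s`. -/
def outlierRatio (K s : ℕ) : ℝ := ((K : ℝ) - s) / s

/-- The lower-bound rate for the target mixture parameters:
`√(p/(n_S+n₀)) + min(ε/√(maxₖ nₖ), √(1/n₀)) + min(h_w, √(1/n₀)) + min(h_μ, √(p/n₀))
+ min(h_β, √(p/n₀))`. -/
def transferRate (p K s n0 : ℕ) (n : Fin K → ℕ) (S : Finset (Fin K)) (hw hμ hβ : ℝ) : ℝ :=
  √((p : ℝ) / ((∑ k ∈ S, n k : ℕ) + n0 : ℝ))
    + min (outlierRatio K s / √((Finset.univ.sup n : ℕ) : ℝ)) √(1 / (n0 : ℝ))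
    + min hw √(1 / (n0 : ℝ))
    + min hμ √((p : ℝ) / n0)
    + min hβ √((p : ℝ) / n0)

end

/-! The rate is a sum of five terms, so it is at most five times its largest term, and it suffices
to prove one lower bound per term. Each comes from Assouad's lemma (`assouad`) on a hypercube of
parameters, a cube of dimension one being a two-point test. Closeness of neighbouring vertices is
measured by the order-two Rényi divergence, which adds over independent observations.

Four terms use the set `S` of all sources. For `√(p/(n_S+n₀))` all tasks share one parameter, whose
two means are translated together along the cube. For the terms in `h_w`, `h_μ`, `h_β` the sources
are frozen at a reference parameter and only the target moves, within the allowed radius, so that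
only the `n₀` target observations are informative. For `β` the means are fixed and the precision
matrix is `I - y yᵀ`; moving `y` around `ρ eᵢ`, rather than around `0`, makes `β` change at first
order. The covariance bound uses `I + v vᵀ` in the same way, with equal means: then `β = 0` whatever
the covariance, and the sources give no help at any radius.

The outlier term is of another nature (`exists_transferLaw_ge_of_outliers`). Each source is
contaminated as a whole, independently, with probability `e = (K-s)/(100K)`. If two proportions
differ by at most a small multiple of `ε/√(max nₖ)`, the sample laws of each source are within `e`
in total variation, and suitable contaminations make the two contaminated laws equal
(`exists_common_contamination`). The sources then reveal nothing about the proportion. The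
contaminated experiment is an average of admissible models over the random set `S` of clean sources
(`prod_pi_mixture_real`). By Markov's inequality `S` usually has at least `s` elements and at least
half of the observations, so some such `S` inherits the error bound
(`exists_of_sum_bernoulliWeight_ge`). -/

/-- The Rényi divergence of order two of `P` with respect to `Q` is at most `t`, stated through the
Cauchy–Schwarz type inequality `(∫ f dP)² ≤ eᵗ ∫ f² dQ` for nonnegative `f`. -/
def RenyiTwoLE {X : Type*} [MeasurableSpace X] (P Q : Measure X) (t : ℝ) : Prop :=
  ∀ f : X → ℝ≥0∞, Measurable f →
    (∫⁻ x, f x ∂P) ^ 2 ≤ ENNReal.ofReal (Real.exp t) * ∫⁻ x, f x ^ 2 ∂Q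

/-! ### Calculus of the order-two Rényi divergence. -/

section General

variable {X Y : Type*} [MeasurableSpace X] [MeasurableSpace Y]

theorem sq_lintegral_mul_le (μ : Measure X) {f g : X → ℝ≥0∞} (hf : Measurable f)
    (hg : Measurable g) :
    (∫⁻ x, f x * g x ∂μ) ^ 2 ≤ (∫⁻ x, f x ^ 2 ∂μ) * ∫⁻ x, g x ^ 2 ∂μ := by
  have h := ENNReal.lintegral_mul_le_Lp_mul_Lq μ Real.HolderConjugate.two_two hf.aemeasurable
    hg.aemeasurable
  have h2 := pow_le_pow_left' h 2
  simp only [Pi.mul_apply, ENNReal.rpow_two] at h2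
  refine h2.trans (le_of_eq ?_)
  rw [mul_pow, ← ENNReal.rpow_natCast, ← ENNReal.rpow_natCast, ← ENNReal.rpow_mul,
    ← ENNReal.rpow_mul]
  norm_num

theorem sq_lintegral_le (μ : Measure X) [IsProbabilityMeasure μ] {f : X → ℝ≥0∞}
    (hf : Measurable f) : (∫⁻ x, f x ∂μ) ^ 2 ≤ ∫⁻ x, f x ^ 2 ∂μ := by
  simpa using sq_lintegral_mul_le μ measurable_one hf

namespace RenyiTwoLE

theorem refl (P : Measure X) [IsProbabilityMeasure P] : RenyiTwoLE P P 0 := fun f hf => by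
  simpa using sq_lintegral_le P hf

theorem mono {P Q : Measure X} {s t : ℝ} (h : RenyiTwoLE P Q s) (hst : s ≤ t) :
    RenyiTwoLE P Q t := fun f hf =>
  (h f hf).trans (by gcongr)

theorem map {P Q : Measure X} {t : ℝ} (h : RenyiTwoLE P Q t) {T : X → Y} (hT : Measurable T) :
    RenyiTwoLE (P.map T) (Q.map T) t := fun f hf => by
  rw [lintegral_map hf hT, lintegral_map (hf.pow_const 2) hT]
  exact h _ (hf.comp hT)

/-- Fubini: the first bound applies to the partial integral `x ↦ ∫ f(x, ·) dP'`, the second to each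
slice. Stating the divergence as an inequality means that no density has to be multiplied. -/
theorem prod {P Q : Measure X} {P' Q' : Measure Y} [SFinite P'] [SFinite Q'] {s t : ℝ}
    (h : RenyiTwoLE P Q s) (h' : RenyiTwoLE P' Q' t) :
    RenyiTwoLE (P.prod P') (Q.prod Q') (s + t) := fun f hf => by
  rw [lintegral_prod _ hf.aemeasurable, lintegral_prod _ (hf.pow_const 2).aemeasurable,
    Real.exp_add, ENNReal.ofReal_mul (Real.exp_pos _).le, mul_assoc]
  refine (h _ hf.lintegral_prod_right').trans ?_
  gcongr
  rw [← lintegral_const_mul _ (hf.pow_const 2).lintegral_prod_right']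
  exact lintegral_mono fun x => h' _ (hf.comp measurable_prodMk_left)

theorem pi_fin {n : ℕ} {X : Fin n → Type*} [∀ i, MeasurableSpace (X i)]
    {P Q : ∀ i, Measure (X i)} [∀ i, IsProbabilityMeasure (P i)]
    [∀ i, IsProbabilityMeasure (Q i)] {t : Fin n → ℝ} (h : ∀ i, RenyiTwoLE (P i) (Q i) (t i)) :
    RenyiTwoLE (Measure.pi P) (Measure.pi Q) (∑ i, t i) := by
  induction n with
  | zero =>
    have : P = Q := funext fun i => i.elim0
    subst this
    simpa using refl (Measure.pi P)
  | succ n ih =>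
    rw [← ((measurePreserving_piFinSuccAbove P 0).symm).map_eq,
      ← ((measurePreserving_piFinSuccAbove Q 0).symm).map_eq, Fin.sum_univ_succ]
    exact ((h 0).prod (ih fun i => h _)).map (MeasurableEquiv.measurable _)

theorem pi {ι : Type*} [Fintype ι] {X : ι → Type*} [∀ i, MeasurableSpace (X i)]
    {P Q : ∀ i, Measure (X i)} [∀ i, IsProbabilityMeasure (P i)]
    [∀ i, IsProbabilityMeasure (Q i)] {t : ι → ℝ} (h : ∀ i, RenyiTwoLE (P i) (Q i) (t i)) :
    RenyiTwoLE (Measure.pi P) (Measure.pi Q) (∑ i, t i) := by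
  have e := (Fintype.equivFin ι).symm
  rw [← (measurePreserving_piCongrLeft P e).map_eq, ← (measurePreserving_piCongrLeft Q e).map_eq,
    ← e.sum_comp]
  exact (pi_fin fun i => h (e i)).map (MeasurableEquiv.measurable _)

theorem pi_const {n : ℕ} {P Q : Measure X} [IsProbabilityMeasure P] [IsProbabilityMeasure Q]
    {t : ℝ} (h : RenyiTwoLE P Q t) :
    RenyiTwoLE (Measure.pi fun _ : Fin n => P) (Measure.pi fun _ : Fin n => Q) (n * t) := by
  simpa using pi_fin (n := n) (fun _ => h)

/-- Two binary mixtures: the divergences of the weights (`Σ aᵢ² / bᵢ ≤ eˢ`) and of the components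
add up. -/
theorem mixture {P₁ P₂ Q₁ Q₂ : Measure X} {s t : ℝ} {a₁ a₂ b₁ b₂ : ℝ} (ha₁ : 0 ≤ a₁)
    (ha₂ : 0 ≤ a₂) (hb₁ : 0 < b₁) (hb₂ : 0 < b₂) (hs : a₁ ^ 2 / b₁ + a₂ ^ 2 / b₂ ≤ Real.exp s)
    (h₁ : RenyiTwoLE P₁ Q₁ t) (h₂ : RenyiTwoLE P₂ Q₂ t) :
    RenyiTwoLE (ENNReal.ofReal a₁ • P₁ + ENNReal.ofReal a₂ • P₂)
      (ENNReal.ofReal b₁ • Q₁ + ENNReal.ofReal b₂ • Q₂) (s + t) := fun f hf => by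
  have key : ∀ x y X' Y' : ℝ≥0∞, x ^ 2 ≤ ENNReal.ofReal (Real.exp t) * X' →
      y ^ 2 ≤ ENNReal.ofReal (Real.exp t) * Y' →
      (ENNReal.ofReal a₁ * x + ENNReal.ofReal a₂ * y) ^ 2 ≤
        ENNReal.ofReal (Real.exp (s + t)) * (ENNReal.ofReal b₁ * X' + ENNReal.ofReal b₂ * Y') := by
    intro x y X' Y' hx hy
    rw [Real.exp_add, ENNReal.ofReal_mul (Real.exp_pos _).le, mul_assoc]
    have hexp : ENNReal.ofReal (Real.exp t) ≠ 0 := by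
      simpa using Real.exp_pos t
    have hexs : ENNReal.ofReal (Real.exp s) ≠ 0 := by
      simpa using Real.exp_pos s
    rcases eq_or_ne X' ∞ with rfl | hX'
    · rw [ENNReal.mul_top (by simpa using hb₁), top_add, ENNReal.mul_top hexp,
        ENNReal.mul_top hexs]
      exact le_top
    rcases eq_or_ne Y' ∞ with rfl | hY'
    · rw [ENNReal.mul_top (by simpa using hb₂), add_top, ENNReal.mul_top hexp,
        ENNReal.mul_top hexs]
      exact le_top
    have hx' : x ≠ ∞ := by
      rintro rfl
      simp [ENNReal.mul_eq_top, hX'] at hx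
    have hy' : y ≠ ∞ := by
      rintro rfl
      simp [ENNReal.mul_eq_top, hY'] at hy
    lift x to NNReal using hx'
    lift y to NNReal using hy'
    lift X' to NNReal using hX'
    lift Y' to NNReal using hY'
    have hE := (Real.exp_pos t).le
    have hS := (Real.exp_pos s).le
    rw [← ENNReal.ofReal_coe_nnreal (p := x), ← ENNReal.ofReal_coe_nnreal (p := X')] at *
    rw [← ENNReal.ofReal_coe_nnreal (p := y), ← ENNReal.ofReal_coe_nnreal (p := Y')] at *
    rw [← ENNReal.ofReal_pow (by positivity), ← ENNReal.ofReal_mul hE,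
      ENNReal.ofReal_le_ofReal_iff (by positivity)] at hx hy
    rw [← ENNReal.ofReal_mul ha₁, ← ENNReal.ofReal_mul ha₂, ← ENNReal.ofReal_mul hb₁.le,
      ← ENNReal.ofReal_mul hb₂.le, ← ENNReal.ofReal_add (by positivity) (by positivity),
      ← ENNReal.ofReal_add (by positivity) (by positivity), ← ENNReal.ofReal_mul hE,
      ← ENNReal.ofReal_mul hS, ← ENNReal.ofReal_pow (by positivity)]
    apply ENNReal.ofReal_le_ofReal
    -- Cauchy–Schwarz for the vectors `aᵢ / √bᵢ` and `√bᵢ xᵢ`.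
    have hcs : (a₁ * x + a₂ * y : ℝ) ^ 2 ≤
        (a₁ ^ 2 / b₁ + a₂ ^ 2 / b₂) * (b₁ * (x : ℝ) ^ 2 + b₂ * (y : ℝ) ^ 2) := by
      have : (a₁ ^ 2 / b₁ + a₂ ^ 2 / b₂) * (b₁ * (x : ℝ) ^ 2 + b₂ * (y : ℝ) ^ 2) -
          (a₁ * x + a₂ * y : ℝ) ^ 2 = (a₁ * b₂ * y - a₂ * b₁ * x) ^ 2 / (b₁ * b₂) := by
        field_simp
        ring
      have h0 : 0 ≤ (a₁ * b₂ * y - a₂ * b₁ * x) ^ 2 / (b₁ * b₂) := by positivity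
      linarith
    refine hcs.trans (mul_le_mul hs ?_ (by positivity) hS)
    nlinarith
  simp only [lintegral_add_measure, lintegral_smul_measure, smul_eq_mul]
  exact key _ _ _ _ (h₁ f hf) (h₂ f hf)

/-- The divergence between the two Bernoulli laws of the event `A` is obtained from functions
constant on `A` and on its complement; this controls the total variation distance. -/
theorem sq_sub_le {P Q : Measure X} [IsProbabilityMeasure P] [IsProbabilityMeasure Q] {t : ℝ}
    (h : RenyiTwoLE P Q t) {A : Set X} (hA : MeasurableSet A) :
    (P.real A - Q.real A) ^ 2 ≤ (Real.exp t - 1) / 4 := by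
  have key : ∀ α β : ℝ, 0 ≤ α → 0 ≤ β → (α * P.real A + β * (1 - P.real A)) ^ 2 ≤
      Real.exp t * (α ^ 2 * Q.real A + β ^ 2 * (1 - Q.real A)) := by
    intro α β hα hβ
    have hm : Measurable fun x => A.indicator (fun _ => ENNReal.ofReal α) x +
        Aᶜ.indicator (fun _ => ENNReal.ofReal β) x :=
      (measurable_const.indicator hA).add (measurable_const.indicator hA.compl)
    have h1 := h _ hm
    have hsq : ∀ x, (A.indicator (fun _ => ENNReal.ofReal α) x +
        Aᶜ.indicator (fun _ => ENNReal.ofReal β) x) ^ 2 =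
        A.indicator (fun _ => ENNReal.ofReal (α ^ 2)) x +
        Aᶜ.indicator (fun _ => ENNReal.ofReal (β ^ 2)) x := by
      intro x
      by_cases hx : x ∈ A <;> simp [hx, ENNReal.ofReal_pow, hα, hβ]
    simp only [hsq] at h1
    rw [lintegral_add_left (measurable_const.indicator hA),
      lintegral_add_left (measurable_const.indicator hA), lintegral_indicator_const hA,
      lintegral_indicator_const hA, lintegral_indicator_const hA.compl,
      lintegral_indicator_const hA.compl, ← ofReal_measureReal, ← ofReal_measureReal,
      ← ofReal_measureReal, ← ofReal_measureReal, probReal_compl_eq_one_sub hA,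
      probReal_compl_eq_one_sub hA] at h1
    have hp := measureReal_nonneg (μ := P) (s := A)
    have hq := measureReal_nonneg (μ := Q) (s := A)
    have hp1 : 0 ≤ 1 - P.real A := sub_nonneg.2 measureReal_le_one
    have hq1 : 0 ≤ 1 - Q.real A := sub_nonneg.2 measureReal_le_one
    rw [← ENNReal.ofReal_mul (by positivity), ← ENNReal.ofReal_mul (by positivity),
      ← ENNReal.ofReal_mul (by positivity), ← ENNReal.ofReal_mul (by positivity),
      ← ENNReal.ofReal_add (by positivity) (by positivity),
      ← ENNReal.ofReal_add (by positivity) (by positivity), ← ENNReal.ofReal_pow (by positivity),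
      ← ENNReal.ofReal_mul (by positivity), ENNReal.ofReal_le_ofReal_iff (by positivity)] at h1
    exact h1
  have hp := measureReal_nonneg (μ := P) (s := A)
  have hq := measureReal_nonneg (μ := Q) (s := A)
  have hp1 : P.real A ≤ 1 := measureReal_le_one
  have hq1 : Q.real A ≤ 1 := measureReal_le_one
  set p := P.real A
  set q := Q.real A
  have hE := Real.exp_pos t
  have h1 := key 1 1 zero_le_one zero_le_one
  ring_nf at h1
  -- The optimal values are the likelihood ratios `p / q` and `(1 - p) / (1 - q)`; multiplying by `q
  -- (1 - q)` avoids division by zero.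
  have h2 := key (p * (1 - q)) ((1 - p) * q) (by nlinarith) (by nlinarith)
  have h3 : (p - q) ^ 2 ≤ (Real.exp t - 1) * (q * (1 - q)) := by
    set D := p ^ 2 * (1 - q) + (1 - p) ^ 2 * q with hD
    have e1 : p * (1 - q) * p + (1 - p) * q * (1 - p) = D := by ring
    have e2 : (p * (1 - q)) ^ 2 * q + ((1 - p) * q) ^ 2 * (1 - q) = q * (1 - q) * D := by ring
    rw [e1, e2] at h2
    have e3 : (p - q) ^ 2 = D - q * (1 - q) := by ring
    rw [e3]
    have hD0 : 0 ≤ D := by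
      have := sub_nonneg.2 hq1
      positivity
    rcases hD0.eq_or_lt with h | h
    · rw [← h] at e3 ⊢
      have : 0 ≤ q * (1 - q) := mul_nonneg hq (by linarith)
      nlinarith
    · have : D ≤ Real.exp t * (q * (1 - q)) := by
        by_contra! hlt
        nlinarith
      linarith
  have h4 : q * (1 - q) ≤ 1 / 4 := by nlinarith [sq_nonneg (q - 1 / 2)]
  nlinarith

/-- The testing errors between two close hypotheses. -/
theorem real_compl_add_real_ge {P Q : Measure X} [IsProbabilityMeasure P] [IsProbabilityMeasure Q]
    {t : ℝ} (h : RenyiTwoLE P Q t) (ht : t ≤ 1 / 5) {A : Set X} (hA : MeasurableSet A) :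
    7 / 10 ≤ P.real Aᶜ + Q.real A := by
  have h1 := h.sq_sub_le hA
  have h2 : Real.exp t ≤ 5 / 4 := by
    have := Real.exp_bound_div_one_sub_of_interval (x := 1 / 5) (by norm_num) (by norm_num)
    have h3 := Real.exp_le_exp.2 ht
    norm_num at this
    linarith
  rw [probReal_compl_eq_one_sub hA]
  nlinarith

end RenyiTwoLE

end General

/-! ### Assouad's lemma. -/

section Assouad

variable {X : Type*} [MeasurableSpace X]

theorem exists_measurable_argmin {ι : Type*} [Fintype ι] [Nonempty ι] [DecidableEq ι]
    (L : ι → X → ℝ) (hL : ∀ i, Measurable (L i)) :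
    ∃ I : X → ι, (∀ i, MeasurableSet {x | I x = i}) ∧ ∀ x i, L (I x) x ≤ L i x := by
  let _ : MeasurableSpace ι := ⊤
  have key : ∀ s : Finset ι, s.Nonempty →
      ∃ I : X → ι, Measurable I ∧ ∀ x, ∀ i ∈ s, L (I x) x ≤ L i x := by
    intro s hs
    induction hs using Finset.Nonempty.cons_induction with
    | singleton a => exact ⟨fun _ => a, measurable_const, by simp⟩
    | cons a s ha hs ih =>
      obtain ⟨I, hI, hmin⟩ := ih
      have hLI : Measurable fun x => L (I x) x := by
        have : Measurable fun q : X × ι => L q.2 q.1 := measurable_from_prod_countable_left hL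
        exact this.comp (measurable_id.prodMk hI)
      classical
      refine ⟨fun x => if L a x ≤ L (I x) x then a else I x,
        Measurable.ite (measurableSet_le (hL a) hLI) measurable_const hI, fun x i hi => ?_⟩
      rw [Finset.mem_cons] at hi
      by_cases h : L a x ≤ L (I x) x
      · simp only [h, if_true]
        rcases hi with rfl | hi
        · exact le_rfl
        · exact h.trans (hmin x i hi)
      · simp only [h, if_false]
        rcases hi with rfl | hi
        · exact (not_le.1 h).le
        · exact hmin x i hi
  obtain ⟨I, hI, hmin⟩ := key Finset.univ Finset.univ_nonempty
  exact ⟨I, fun i => hI (MeasurableSet.of_discrete (s := {i})), fun x i => hmin x i (Finset.mem_univ i)⟩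

/-- **Assouad's lemma** in probability form. -/
theorem assouad {p : ℕ} (hp : 1 ≤ p) (P : (Fin p → Bool) → Measure X)
    [∀ u, IsProbabilityMeasure (P u)] (L : (Fin p → Bool) → X → ℝ) (hL : ∀ u, Measurable (L u))
    {κ t : ℝ} (hκ : 0 ≤ κ)
    (hsep : ∀ u u' x, κ * √(hammingDist u u' : ℝ) ≤ L u x + L u' x)
    (hdiv : ∀ u j, RenyiTwoLE (P (Function.update u j true)) (P (Function.update u j false)) t)
    (ht : t ≤ 1 / 5) :
    ∃ u, 1 / 5 ≤ (P u).real {x | κ / 8 * √p ≤ L u x} := by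
  obtain ⟨I, hI, hmin⟩ := exists_measurable_argmin L hL
  -- The mean Hamming error of the minimizer `I` would be at most `p (1/16 + 1/5)` at every vertex,
  -- whereas testing each coordinate forces an average of at least `7p/20`.
  by_contra! hlt
  have hIj : ∀ j b, MeasurableSet {x | I x j = b} := by
    intro j b
    have : {x | I x j = b} = ⋃ v ∈ {v : Fin p → Bool | v j = b}, {x | I x = v} := by
      ext x; simp
    rw [this]
    exact MeasurableSet.biUnion (Set.to_countable _) fun v _ => hI v
  have hp0 : (0 : ℝ) < p := by exact_mod_cast hp
  -- the mean Hamming error is small at every vertex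
  have hupper : ∀ u, ∑ j, (P u).real {x | I x j ≠ u j} ≤ p / 16 + p * (1 / 5) := by
    intro u
    have hne : ∀ j, MeasurableSet {x | I x j ≠ u j} := fun j => (hIj j _).compl
    have hint : ∑ j, (P u).real {x | I x j ≠ u j} = ∫ x, (hammingDist (I x) u : ℝ) ∂(P u) := by
      have : ∀ x, (hammingDist (I x) u : ℝ) =
          ∑ j, {x | I x j ≠ u j}.indicator (fun _ => (1 : ℝ)) x := by
        intro x
        simp only [hammingDist, Set.indicator_apply, Set.mem_ofPred_eq, Finset.sum_boole]
      simp_rw [this]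
      rw [integral_finsetSum]
      · refine Finset.sum_congr rfl fun j _ => ?_
        rw [integral_indicator_const _ (hne j)]
        simp
      · intro j _
        exact (integrable_const _).indicator (hne j)
    have hA : MeasurableSet {x | κ / 8 * √p ≤ L u x} := measurableSet_le measurable_const (hL u)
    have hle : ∀ x, (hammingDist (I x) u : ℝ) ≤
        p / 16 + {x | κ / 8 * √p ≤ L u x}.indicator (fun _ => (p : ℝ)) x := by
      intro x
      have hcard : (hammingDist (I x) u : ℝ) ≤ p := by
        exact_mod_cast (hammingDist_le_card_fintype (x := I x) (y := u)).trans (by simp)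
      by_cases hx : κ / 8 * √p ≤ L u x
      · rw [Set.indicator_of_mem (by exact hx)]
        linarith
      · rw [Set.indicator_of_notMem (by exact hx), add_zero]
        by_contra! hd
        apply hx
        -- As `I x` minimizes the loss, `κ √d ≤ L (I x) x + L u x ≤ 2 L u x` with `d` the Hamming
        -- distance; so `d > p/16` would make `L u x` reach `κ √p / 8`.
        have h1 := hsep (I x) u x
        have h2 := hmin x u
        have h3 : √p / 4 ≤ √(hammingDist (I x) u : ℝ) := by
          rw [show √p / 4 = √((p : ℝ) / 16) by
            rw [Real.sqrt_div hp0.le, show (16 : ℝ) = 4 ^ 2 by norm_num,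
              Real.sqrt_sq (by norm_num)]]
          exact Real.sqrt_le_sqrt hd.le
        nlinarith [mul_le_mul_of_nonneg_left h3 hκ]
    rw [hint]
    calc ∫ x, (hammingDist (I x) u : ℝ) ∂(P u)
        ≤ ∫ x, (p / 16 + {x | κ / 8 * √p ≤ L u x}.indicator (fun _ => (p : ℝ)) x) ∂(P u) := by
          refine integral_mono_of_nonneg (ae_of_all _ fun x => by positivity) ?_ (ae_of_all _ hle)
          exact (integrable_const _).add ((integrable_const _).indicator hA)
      _ = p / 16 + (P u).real {x | κ / 8 * √p ≤ L u x} * p := by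
          rw [integral_add (integrable_const _) ((integrable_const _).indicator hA),
            integral_indicator_const _ hA]
          simp
      _ ≤ _ := by nlinarith [hlt u]
  have hsum : ∀ j, ∑ u : Fin p → Bool, (7 / 20 : ℝ) ≤ ∑ u, (P u).real {x | I x j ≠ u j} := by
    intro j
    -- Flipping coordinate `j` pairs each vertex with a neighbour, and the two errors of a pair are
    -- those of a test between close laws.
    have hinv : Function.Involutive fun u : Fin p → Bool => Function.update u j (!u j) := by
      intro u
      simp
    set σ := hinv.toPerm _
    have hre := Equiv.sum_comp σ fun u => (P u).real {x | I x j ≠ u j}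
    have hpair : ∀ u : Fin p → Bool, (7 / 10 : ℝ) ≤ (P u).real {x | I x j ≠ u j} +
        (P (σ u)).real {x | I x j ≠ σ u j} := by
      intro u
      have h := (hdiv u j).real_compl_add_real_ge ht (hIj j true)
      have e1 : {x | I x j = true}ᶜ = {x | I x j ≠ true} := rfl
      have e2 : {x | I x j = true} = {x | I x j ≠ false} := by ext; simp
      rw [e1, e2] at h
      rcases hu : u j with _ | _
      · have h3 : Function.update u j false = u := by rw [← hu, Function.update_eq_self]
        have h4 : σ u = Function.update u j true := by simp [σ, hu]
        rw [h3] at h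
        rw [h4, Function.update_self]
        linarith
      · have h3 : Function.update u j true = u := by rw [← hu, Function.update_eq_self]
        have h4 : σ u = Function.update u j false := by simp [σ, hu]
        rw [h3] at h
        rw [h4, Function.update_self]
        linarith
    have h2 := Finset.sum_le_sum fun u (_ : u ∈ Finset.univ) => hpair u
    rw [Finset.sum_add_distrib, hre] at h2
    have h3 : ∑ u : Fin p → Bool, (7 / 10 : ℝ) = 2 * ∑ u : Fin p → Bool, (7 / 20 : ℝ) := by
      rw [Finset.mul_sum]; norm_num
    linarith
  have h1 : ∑ j : Fin p, ∑ u : Fin p → Bool, (7 / 20 : ℝ) ≤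
      ∑ u : Fin p → Bool, (p / 16 + p * (1 / 5) : ℝ) := by
    refine (Finset.sum_le_sum fun j _ => hsum j).trans ?_
    rw [Finset.sum_comm]
    exact Finset.sum_le_sum fun u _ => hupper u
  simp only [Finset.sum_const, Finset.card_univ, nsmul_eq_mul, Fintype.card_fin] at h1
  have hN : (0 : ℝ) < Fintype.card (Fin p → Bool) := by exact_mod_cast Fintype.card_pos
  nlinarith [mul_pos hN hp0]

end Assouad

/-! ### Divergences between Gaussian laws: shifts and rank-one covariance perturbations. -/

section Gaussian

open scoped RealInnerProductSpace

theorem gaussianReal_eq_withDensity (a b : ℝ) :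
    gaussianReal a 1 = (gaussianReal b 1).withDensity
      fun x => ENNReal.ofReal (Real.exp ((a - b) * (x - b) - (a - b) ^ 2 / 2)) := by
  rw [gaussianReal_of_var_ne_zero _ one_ne_zero, gaussianReal_of_var_ne_zero _ one_ne_zero,
    ← withDensity_mul _ (by fun_prop) (by fun_prop)]
  congr 1
  ext x
  rw [Pi.mul_apply, gaussianPDF_def, gaussianPDF_def,
    ← ENNReal.ofReal_mul (gaussianPDFReal_nonneg _ _ _), gaussianPDFReal_def, gaussianPDFReal_def]
  beta_reduce
  congr 1
  rw [mul_assoc _ (Real.exp _) (Real.exp _), ← Real.exp_add]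
  congr 2
  simp only [NNReal.coe_one]
  ring

theorem renyiTwoLE_gaussianReal (a b : ℝ) :
    RenyiTwoLE (gaussianReal a 1) (gaussianReal b 1) ((a - b) ^ 2) := fun f hf => by
  set g : ℝ → ℝ≥0∞ := fun x =>
    ENNReal.ofReal (Real.exp ((a - b) * (x - b) - (a - b) ^ 2 / 2)) with hg
  have hgm : Measurable g := by fun_prop
  have h1 : ∫⁻ x, f x ∂(gaussianReal a 1) = ∫⁻ x, g x * f x ∂(gaussianReal b 1) := by
    rw [gaussianReal_eq_withDensity a b, lintegral_withDensity_eq_lintegral_mul _ hgm hf]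
    rfl
  have h2 : ∫⁻ x, g x ^ 2 ∂(gaussianReal b 1) = ENNReal.ofReal (Real.exp ((a - b) ^ 2)) := by
    -- Completing the square: the squared likelihood ratio is `exp ((a - b)²)` times the likelihood
    -- ratio of the mean `2a - b`, which integrates to one.
    have h3 : ∀ x, g x ^ 2 = ENNReal.ofReal (Real.exp ((a - b) ^ 2)) *
        ENNReal.ofReal (Real.exp (((2 * a - b) - b) * (x - b) - ((2 * a - b) - b) ^ 2 / 2)) := by
      intro x
      rw [hg, ← ENNReal.ofReal_pow (Real.exp_pos _).le, ← ENNReal.ofReal_mul (Real.exp_pos _).le,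
        ← Real.exp_add, ← Real.exp_nat_mul]
      congr 2
      push_cast
      ring
    simp_rw [h3]
    rw [lintegral_const_mul _ (by fun_prop), ← setLIntegral_univ, ← withDensity_apply _ .univ,
      ← gaussianReal_eq_withDensity, measure_univ, mul_one]
  rw [h1, ← h2]
  exact sq_lintegral_mul_le _ hgm hf

variable {ι : Type*} [Fintype ι]

theorem map_const_add_stdGaussian (a : EuclideanSpace ℝ ι) :
    (stdGaussian (EuclideanSpace ℝ ι)).map (fun x => a + x) =
      (Measure.pi fun i => gaussianReal (a i) 1).map (WithLp.toLp 2) := by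
  have h : (Measure.pi fun i => gaussianReal (a i) 1) =
      (Measure.pi fun _ : ι => gaussianReal 0 1).map fun x i => a i + x i := by
    rw [Measure.pi_map_pi (f := fun i x => a i + x) (fun i => by fun_prop)]
    simp [gaussianReal_map_const_add]
  rw [h, ← map_pi_eq_stdGaussian, Measure.map_map (by fun_prop) (by fun_prop),
    Measure.map_map (by fun_prop) (by fun_prop)]
  rfl

theorem renyiTwoLE_stdGaussian_shift (a b : EuclideanSpace ℝ ι) :
    RenyiTwoLE ((stdGaussian (EuclideanSpace ℝ ι)).map fun x => a + x)
      ((stdGaussian (EuclideanSpace ℝ ι)).map fun x => b + x) (‖a - b‖ ^ 2) := by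
  rw [map_const_add_stdGaussian, map_const_add_stdGaussian, EuclideanSpace.real_norm_sq_eq]
  exact (RenyiTwoLE.pi fun i => renyiTwoLE_gaussianReal (a i) (b i)).map (by fun_prop)

theorem lintegral_exp_mul_sq_gaussianReal {a : ℝ} (ha0 : 0 ≤ a) (ha : a ≤ 1 / 4) :
    ∫⁻ x, ENNReal.ofReal (Real.exp (a * x ^ 2)) ∂(gaussianReal 0 1) ≤
      ENNReal.ofReal (Real.exp (2 * a)) := by
  have hpos : 0 < 1 - 2 * a := by linarith
  set v : NNReal := ⟨(1 - 2 * a)⁻¹, by positivity⟩ with hv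
  have hvr : (v : ℝ) = (1 - 2 * a)⁻¹ := rfl
  have hv0 : v ≠ 0 := by
    intro h
    have : (v : ℝ) = 0 := by rw [h]; rfl
    rw [hvr] at this
    exact hpos.ne' (inv_eq_zero.1 this)
  -- Exponential tilting turns the standard Gaussian into a multiple of the one with variance `1 /
  -- (1 - 2a)`.
  have h1 : ∀ x, gaussianPDF 0 1 x * ENNReal.ofReal (Real.exp (a * x ^ 2)) =
      ENNReal.ofReal (√(1 - 2 * a))⁻¹ * gaussianPDF 0 v x := by
    intro x
    rw [gaussianPDF_def, gaussianPDF_def, ← ENNReal.ofReal_mul (gaussianPDFReal_nonneg _ _ _),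
      ← ENNReal.ofReal_mul (by positivity), gaussianPDFReal_def, gaussianPDFReal_def]
    congr 1
    rw [mul_assoc, ← Real.exp_add, ← mul_assoc, hvr, NNReal.coe_one, mul_one,
      Real.sqrt_mul (x := 2 * Real.pi) (by positivity) (1 - 2 * a)⁻¹, Real.sqrt_inv, mul_inv,
      inv_inv]
    congr 1
    · have := Real.sqrt_pos.2 hpos
      field_simp
    · congr 1
      field_simp
      ring
  rw [gaussianReal_of_var_ne_zero _ one_ne_zero,
    lintegral_withDensity_eq_lintegral_mul _ (by fun_prop) (by fun_prop)]
  simp only [Pi.mul_apply, h1]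
  rw [lintegral_const_mul _ (by fun_prop), lintegral_gaussianPDF_eq_one _ hv0, mul_one]
  apply ENNReal.ofReal_le_ofReal
  rw [← Real.sqrt_inv]
  apply Real.sqrt_le_iff.2 ⟨(Real.exp_pos _).le, ?_⟩
  rw [← Real.exp_nat_mul, inv_le_iff_one_le_mul₀ hpos]
  -- It remains that `(1 - 2a)(1 + 4a) ≥ 1`, which is where `a ≤ 1/4` is used.
  have h2 := Real.add_one_le_exp (↑2 * (2 * a))
  push_cast at h2 ⊢
  nlinarith

variable [DecidableEq ι]

theorem multivariateGaussian_one (μ : EuclideanSpace ℝ ι) :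
    multivariateGaussian μ (1 : Matrix ι ι ℝ) =
      (stdGaussian (EuclideanSpace ℝ ι)).map fun x => μ + x := by
  simp [multivariateGaussian]

/-- The spiked covariance matrix `I + v vᵀ`. -/
def spikedCov (v : EuclideanSpace ℝ ι) : Matrix ι ι ℝ :=
  1 + Matrix.vecMulVec v v

theorem spikedCov_mulVec (v x : EuclideanSpace ℝ ι) :
    (spikedCov v).mulVec x = WithLp.ofLp (x + ⟪v, x⟫ • v) := by
  ext i
  simp [spikedCov, Matrix.add_mulVec, Matrix.vecMulVec_mulVec, EuclideanSpace.inner_eq_star_dotProduct,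
    dotProduct_comm]

theorem spikedCov_posSemidef (v : EuclideanSpace ℝ ι) : (spikedCov v).PosSemidef := by
  have := Matrix.posSemidef_vecMulVec_self_star (WithLp.ofLp v)
  rw [star_trivial] at this
  exact Matrix.PosSemidef.one.add this

/-- A spike is an independent random shift along `v`. This reduces covariance perturbations to mean
shifts; both sides have the same characteristic function. -/
theorem multivariateGaussian_spikedCov (μ v : EuclideanSpace ℝ ι) :
    multivariateGaussian μ (spikedCov v) =
      ((gaussianReal 0 1).prod (stdGaussian (EuclideanSpace ℝ ι))).map
        fun q => (μ + q.1 • v) + q.2 := by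
  have hm : Measurable fun q : ℝ × EuclideanSpace ℝ ι => (μ + q.1 • v) + q.2 := by fun_prop
  have := Measure.isProbabilityMeasure_map
    (μ := (gaussianReal 0 1).prod (stdGaussian (EuclideanSpace ℝ ι))) hm.aemeasurable
  apply Measure.ext_of_charFun
  ext t
  rw [charFun_multivariateGaussian (spikedCov_posSemidef v), spikedCov_mulVec, charFun_apply,
    integral_map hm.aemeasurable (by fun_prop)]
  have h : ∀ q : ℝ × EuclideanSpace ℝ ι,
      Complex.exp ((⟪(μ + q.1 • v) + q.2, t⟫ : ℝ) * Complex.I) =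
      Complex.exp ((⟪μ, t⟫ : ℝ) * Complex.I) *
        (Complex.exp ((⟪q.1, (⟪v, t⟫ : ℝ)⟫ : ℝ) * Complex.I) *
          Complex.exp ((⟪q.2, t⟫ : ℝ) * Complex.I)) := by
    intro q
    rw [← Complex.exp_add, ← Complex.exp_add]
    congr 1
    simp only [inner_add_left, real_inner_smul_left, RCLike.inner_apply, conj_trivial]
    push_cast
    ring
  simp_rw [h]
  rw [integral_const_mul, integral_prod_mul (fun x : ℝ => Complex.exp ((⟪x, (⟪v, t⟫ : ℝ)⟫ : ℝ) * Complex.I))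
    (fun z : EuclideanSpace ℝ ι => Complex.exp ((⟪z, t⟫ : ℝ) * Complex.I)), ← charFun_apply,
    ← charFun_apply, charFun_stdGaussian, charFun_gaussianReal, ← Complex.exp_add,
    ← Complex.exp_add, real_inner_comm]
  congr 1
  have e : WithLp.ofLp t ⬝ᵥ WithLp.ofLp (t + ⟪v, t⟫ • v) = ‖t‖ ^ 2 + ⟪v, t⟫ ^ 2 := by
    have : WithLp.ofLp t ⬝ᵥ WithLp.ofLp (t + ⟪v, t⟫ • v) = ⟪t + ⟪v, t⟫ • v, t⟫ := by
      simp [EuclideanSpace.inner_eq_star_dotProduct]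
    rw [this, inner_add_left, real_inner_smul_left, real_inner_self_eq_norm_sq]
    ring
  rw [e]
  push_cast
  simp
  ring

/-- Coupling the two laws through the same scalar Gaussian `ξ`, they are shifts of each other by `ξ
(v - v')`, with divergence `ξ² ‖v - v'‖²` given `ξ`. Cauchy–Schwarz in `ξ` leaves an exponential
moment of `ξ²`, finite for small `‖v - v'‖`. -/
theorem renyiTwoLE_spikedCov (μ v v' : EuclideanSpace ℝ ι) (h : ‖v - v'‖ ^ 2 ≤ 1 / 4) :
    RenyiTwoLE (multivariateGaussian μ (spikedCov v)) (multivariateGaussian μ (spikedCov v'))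
      (2 * ‖v - v'‖ ^ 2) := fun f hf => by
  set G := stdGaussian (EuclideanSpace ℝ ι)
  rw [multivariateGaussian_spikedCov, multivariateGaussian_spikedCov,
    lintegral_map hf (by fun_prop), lintegral_map (by fun_prop) (by fun_prop),
    lintegral_prod _ (by fun_prop), lintegral_prod _ (by fun_prop)]
  have hpt : ∀ ξ : ℝ, ∫⁻ z, f ((μ + ξ • v) + z) ∂G ≤
      (ENNReal.ofReal (Real.exp (‖v - v'‖ ^ 2 * ξ ^ 2))) ^ (1 / 2 : ℝ) *
        (∫⁻ z, f ((μ + ξ • v') + z) ^ 2 ∂G) ^ (1 / 2 : ℝ) := by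
    intro ξ
    have h1 := renyiTwoLE_stdGaussian_shift (μ + ξ • v) (μ + ξ • v') f hf
    rw [lintegral_map hf (by fun_prop), lintegral_map (by fun_prop) (by fun_prop),
      add_sub_add_left_eq_sub, ← smul_sub, norm_smul, mul_pow, Real.norm_eq_abs, sq_abs,
      mul_comm (ξ ^ 2)] at h1
    rw [← ENNReal.mul_rpow_of_nonneg _ _ (by norm_num)]
    refine le_trans (le_of_eq ?_) (ENNReal.rpow_le_rpow h1 (by norm_num))
    rw [← ENNReal.rpow_natCast, ← ENNReal.rpow_mul]
    norm_num [G]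
  have hhalf : ∀ x : ℝ≥0∞, (x ^ (1 / 2 : ℝ)) ^ 2 = x := by
    intro x
    rw [← ENNReal.rpow_natCast, ← ENNReal.rpow_mul]
    norm_num
  have hm : Measurable fun ξ : ℝ => ∫⁻ z, f ((μ + ξ • v') + z) ^ 2 ∂G :=
    Measurable.lintegral_prod_right' (f := fun q : ℝ × EuclideanSpace ℝ ι =>
      f ((μ + q.1 • v') + q.2) ^ 2) (by fun_prop)
  calc _ ≤ _ := pow_le_pow_left' (lintegral_mono hpt) 2
    _ ≤ _ := sq_lintegral_mul_le _ (by fun_prop) (hm.pow_const _)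
    _ ≤ _ := by
      simp only [hhalf]
      gcongr
      exact lintegral_exp_mul_sq_gaussianReal (by positivity) h

end Gaussian

/-! ### Mixture laws, and the spectrum and `β` of spiked covariances. -/

section Laws

open scoped RealInnerProductSpace

variable {p : ℕ}

theorem GMMParam.isProbabilityMeasure_law {θ : GMMParam p} (h : θ.w ∈ Set.Icc (0 : ℝ) 1) :
    IsProbabilityMeasure θ.law := by
  constructor
  have h1 : 0 ≤ 1 - θ.w := sub_nonneg.2 h.2
  simp only [GMMParam.law, Measure.add_apply, Measure.smul_apply, measure_univ, smul_eq_mul,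
    mul_one]
  rw [← ENNReal.ofReal_add h1 h.1]
  simp

theorem renyiTwoLE_law_of_components {θ θ' : GMMParam p} (hw : θ.w = θ'.w)
    (h : θ.w ∈ Set.Ioo (0 : ℝ) 1) {t : ℝ}
    (h₁ : RenyiTwoLE (multivariateGaussian θ.mu1 θ.cov) (multivariateGaussian θ'.mu1 θ'.cov) t)
    (h₂ : RenyiTwoLE (multivariateGaussian θ.mu2 θ.cov) (multivariateGaussian θ'.mu2 θ'.cov) t) :
    RenyiTwoLE θ.law θ'.law t := by
  have h0 : 0 < 1 - θ.w := sub_pos.2 h.2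
  have hw0 : 0 < θ.w := h.1
  rw [GMMParam.law, GMMParam.law, ← hw, ← zero_add t]
  refine RenyiTwoLE.mixture h0.le hw0.le h0 hw0 (le_of_eq ?_) h₁ h₂
  rw [Real.exp_zero]
  field_simp
  ring

/-- Changing only the mixture proportion away from `1/2`. -/
theorem renyiTwoLE_law_of_weight {w : ℝ} (h : w ∈ Set.Icc (0 : ℝ) 1)
    (a b : EuclideanSpace ℝ (Fin p)) (M : Matrix (Fin p) (Fin p) ℝ) :
    RenyiTwoLE (GMMParam.law ⟨w, a, b, M⟩) (GMMParam.law ⟨1 / 2, a, b, M⟩)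
      (4 * (w - 1 / 2) ^ 2) := by
  rw [← add_zero (4 * (w - 1 / 2) ^ 2)]
  refine RenyiTwoLE.mixture (sub_nonneg.2 h.2) h.1 (by norm_num) (by norm_num) ?_
    (RenyiTwoLE.refl _) (RenyiTwoLE.refl _)
  have := Real.add_one_le_exp (4 * (w - 1 / 2) ^ 2)
  refine le_trans (le_of_eq ?_) this
  ring

theorem renyiTwoLE_law_shift {w : ℝ} (h : w ∈ Set.Ioo (0 : ℝ) 1)
    (a b v v' : EuclideanSpace ℝ (Fin p)) :
    RenyiTwoLE (GMMParam.law ⟨w, a + v, b + v, spikedCov 0⟩)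
      (GMMParam.law ⟨w, a + v', b + v', spikedCov 0⟩) (‖v - v'‖ ^ 2) := by
  have h0 : spikedCov (0 : EuclideanSpace ℝ (Fin p)) = 1 := by simp [spikedCov]
  refine renyiTwoLE_law_of_components (θ := ⟨w, a + v, b + v, spikedCov 0⟩)
    (θ' := ⟨w, a + v', b + v', spikedCov 0⟩) rfl h ?_ ?_ <;>
  · simp only [h0, multivariateGaussian_one]
    rw [← add_sub_add_left_eq_sub v v']
    exact renyiTwoLE_stdGaussian_shift _ _

theorem renyiTwoLE_law_spikedCov {w : ℝ} (h : w ∈ Set.Ioo (0 : ℝ) 1)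
    (a b v v' : EuclideanSpace ℝ (Fin p)) (hv : ‖v - v'‖ ^ 2 ≤ 1 / 4) :
    RenyiTwoLE (GMMParam.law ⟨w, a, b, spikedCov v⟩) (GMMParam.law ⟨w, a, b, spikedCov v'⟩)
      (2 * ‖v - v'‖ ^ 2) :=
  renyiTwoLE_law_of_components (θ := ⟨w, a, b, spikedCov v⟩) (θ' := ⟨w, a, b, spikedCov v'⟩) rfl h
    (renyiTwoLE_spikedCov _ _ _ hv)
    (renyiTwoLE_spikedCov _ _ _ hv)

theorem spectrum_spikedCov_subset (v : EuclideanSpace ℝ (Fin p)) :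
    spectrum ℝ (spikedCov v) ⊆ Set.Icc 1 (1 + ‖v‖ ^ 2) := by
  intro l hl
  rw [← Matrix.spectrum_toLin', ← Module.End.hasEigenvalue_iff_mem_spectrum] at hl
  obtain ⟨x, hx⟩ := hl.exists_hasEigenvector
  have hx0 : x ≠ 0 := hx.2
  have hx1 := hx.apply_eq_smul
  rw [Matrix.toLin'_apply] at hx1
  set z : EuclideanSpace ℝ (Fin p) := WithLp.toLp 2 x with hz
  have hz0 : z ≠ 0 := by simpa [hz] using hx0
  have h1 : z + ⟪v, z⟫ • v = l • z := by
    have := spikedCov_mulVec v z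
    rw [hz, hx1, ← hz] at this
    ext i
    exact (congrFun this i).symm
  have h2 : ‖z‖ ^ 2 + ⟪v, z⟫ ^ 2 = l * ‖z‖ ^ 2 := by
    have := congrArg (fun y => ⟪y, z⟫) h1
    simp only [inner_add_left, real_inner_smul_left, real_inner_self_eq_norm_sq] at this
    linarith
  have hpos : 0 < ‖z‖ ^ 2 := by positivity
  have h3 : ⟪v, z⟫ ^ 2 ≤ ‖v‖ ^ 2 * ‖z‖ ^ 2 := by
    rw [← mul_pow, ← sq_abs]
    gcongr
    exact abs_real_inner_le_norm v z
  constructor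
  · nlinarith [sq_nonneg ⟪v, z⟫]
  · nlinarith

theorem isGMMParam_spikedCov {Mμ cw cS w : ℝ} (hcS : 1 < cS) (hw : w ∈ Set.Ioo cw (1 - cw))
    {a b v : EuclideanSpace ℝ (Fin p)} (ha : ‖a‖ ≤ Mμ) (hb : ‖b‖ ≤ Mμ)
    (hv : ‖v‖ ^ 2 ≤ cS - 1) : IsGMMParam Mμ cw cS ⟨w, a, b, spikedCov v⟩ := by
  refine ⟨max_le ha hb, hw, (spikedCov_posSemidef v).isHermitian,
    (spectrum_spikedCov_subset v).trans (Set.Icc_subset_Icc (inv_le_one_of_one_le₀ hcS.le) ?_)⟩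
  linarith

theorem beta_spikedCov (w : ℝ) (a b v x : EuclideanSpace ℝ (Fin p))
    (h : x + ⟪v, x⟫ • v = a - b) : GMMParam.beta ⟨w, a, b, spikedCov v⟩ = x := by
  have hpd : (spikedCov v).PosDef := by
    have := Matrix.posSemidef_vecMulVec_self_star (WithLp.ofLp v)
    rw [star_trivial] at this
    exact Matrix.PosDef.one.add_posSemidef this
  have := hpd.isUnit.invertible
  rw [GMMParam.beta]
  change WithLp.toLp 2 ((spikedCov v)⁻¹.mulVec (WithLp.ofLp (a - b))) = x
  rw [Matrix.inv_mulVec_eq_vec (v := WithLp.ofLp x)]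
  rw [spikedCov_mulVec, h]

/-- The spike `v` with `(I + v vᵀ)⁻¹ = I - y yᵀ`. -/
noncomputable def inverseSpike (y : EuclideanSpace ℝ (Fin p)) : EuclideanSpace ℝ (Fin p) :=
  (√(1 - ‖y‖ ^ 2))⁻¹ • y

/-- Sherman–Morrison. Parametrizing by the precision matrix makes `β` a polynomial in `y`, so
separation in `β` can be read off coordinatewise. -/
theorem beta_inverseSpike (w : ℝ) (a b y : EuclideanSpace ℝ (Fin p)) (hy : ‖y‖ < 1) :
    GMMParam.beta ⟨w, a, b, spikedCov (inverseSpike y)⟩ = (a - b) - ⟪y, a - b⟫ • y := by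
  apply beta_spikedCov
  have h1 : 0 < 1 - ‖y‖ ^ 2 := by nlinarith [norm_nonneg y]
  have h2 := Real.sqrt_pos.2 h1
  generalize a - b = m
  rw [inverseSpike, real_inner_smul_left, inner_sub_right, real_inner_smul_right,
    real_inner_self_eq_norm_sq, smul_smul]
  have h3 : (√(1 - ‖y‖ ^ 2))⁻¹ * (⟪y, m⟫ - ⟪y, m⟫ * ‖y‖ ^ 2) * (√(1 - ‖y‖ ^ 2))⁻¹ =
      ⟪y, m⟫ := by
    field_simp
    rw [Real.sq_sqrt h1.le]
  rw [h3, sub_add_cancel]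

theorem norm_inverseSpike_sq {y : EuclideanSpace ℝ (Fin p)} (hy : ‖y‖ ≤ 1 / 2) :
    ‖inverseSpike y‖ ^ 2 ≤ 4 / 3 * ‖y‖ ^ 2 := by
  have h1 : 3 / 4 ≤ 1 - ‖y‖ ^ 2 := by nlinarith [norm_nonneg y]
  rw [inverseSpike, norm_smul, mul_pow, Real.norm_eq_abs, sq_abs, inv_pow,
    Real.sq_sqrt (by linarith)]
  gcongr
  rw [inv_le_comm₀ (by linarith) (by norm_num)]
  linarith

/-- The Lipschitz bound transfers closeness of the vectors `y` to closeness of the spikes, hence to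
a divergence bound. The scalar factor is at most `6/5` and is `8/9`-Lipschitz on the ball of radius
`1/2`. -/
theorem norm_inverseSpike_sub_le {y z : EuclideanSpace ℝ (Fin p)} (hy : ‖y‖ ≤ 1 / 2)
    (hz : ‖z‖ ≤ 1 / 2) : ‖inverseSpike y - inverseSpike z‖ ≤ 2 * ‖y - z‖ := by
  have hs : ∀ x : EuclideanSpace ℝ (Fin p), ‖x‖ ≤ 1 / 2 → 1 ≤ (√(1 - ‖x‖ ^ 2))⁻¹ ∧
      ((√(1 - ‖x‖ ^ 2))⁻¹) ^ 2 * (1 - ‖x‖ ^ 2) = 1 ∧ ((√(1 - ‖x‖ ^ 2))⁻¹) ^ 2 ≤ 4 / 3 := by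
    intro x hx
    have h1 : 3 / 4 ≤ 1 - ‖x‖ ^ 2 := by nlinarith [norm_nonneg x]
    have h2 : 0 < √(1 - ‖x‖ ^ 2) := Real.sqrt_pos.2 (by linarith)
    refine ⟨?_, ?_, ?_⟩
    · rw [one_le_inv₀ h2]
      exact Real.sqrt_le_one.2 (by nlinarith [sq_nonneg ‖x‖])
    · rw [inv_pow, Real.sq_sqrt (by linarith), inv_mul_cancel₀ (by linarith)]
    · rw [inv_pow, Real.sq_sqrt (by linarith), inv_le_comm₀ (by linarith) (by norm_num)]
      linarith
  obtain ⟨s1, s2, s3⟩ := hs y hy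
  obtain ⟨t1, t2, t3⟩ := hs z hz
  unfold inverseSpike
  set s := (√(1 - ‖y‖ ^ 2))⁻¹
  set t := (√(1 - ‖z‖ ^ 2))⁻¹
  have hd : |‖y‖ - ‖z‖| ≤ ‖y - z‖ := abs_norm_sub_norm_le y z
  have hst : |s - t| ≤ 8 / 9 * ‖y - z‖ := by
    have e1 : (s - t) * (s + t) = s ^ 2 * t ^ 2 * (‖y‖ + ‖z‖) * (‖y‖ - ‖z‖) := by
      linear_combination (-(s ^ 2)) * t2 + t ^ 2 * s2
    have e2 : |s - t| * (s + t) ≤ 16 / 9 * ‖y - z‖ := by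
      rw [← abs_of_nonneg (show 0 ≤ s + t by linarith), ← abs_mul, e1, abs_mul,
        abs_of_nonneg (by positivity)]
      have e3 : s ^ 2 * t ^ 2 ≤ 4 / 3 * (4 / 3) := by gcongr
      have e4 : s ^ 2 * t ^ 2 * (‖y‖ + ‖z‖) ≤ 16 / 9 := by
        have := norm_nonneg y
        have := norm_nonneg z
        nlinarith
      gcongr
    nlinarith [abs_nonneg (s - t)]
  have e : s • y - t • z = s • (y - z) + (s - t) • z := by module
  rw [e]
  refine (norm_add_le _ _).trans ?_
  rw [norm_smul, norm_smul, Real.norm_eq_abs, Real.norm_eq_abs, abs_of_pos (by linarith)]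
  have hs' : s ≤ 6 / 5 := by nlinarith
  have := norm_nonneg (y - z)
  have := norm_nonneg z
  nlinarith [abs_nonneg (s - t)]

end Laws

/-! ### Hypercubes in Euclidean space and their separation. -/

section Cube

open scoped RealInnerProductSpace

variable {p : ℕ}

/-- The vertex `δ 1_u` of the hypercube `{0, δ}ᵖ`. -/
noncomputable def cubeVec (δ : ℝ) (u : Fin p → Bool) : EuclideanSpace ℝ (Fin p) :=
  WithLp.toLp 2 fun j => if u j then δ else 0

theorem cubeVec_apply (δ : ℝ) (u : Fin p → Bool) (j : Fin p) :
    cubeVec δ u j = if u j then δ else 0 := rfl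

theorem norm_cubeVec_le {δ : ℝ} (hδ : 0 ≤ δ) (u : Fin p → Bool) : ‖cubeVec δ u‖ ≤ δ * √p := by
  rw [EuclideanSpace.norm_eq, ← Real.sqrt_sq hδ, ← Real.sqrt_mul (sq_nonneg _), Real.sqrt_sq hδ]
  apply Real.sqrt_le_sqrt
  have h : ∀ j : Fin p, ‖cubeVec δ u j‖ ^ 2 ≤ δ ^ 2 := by
    intro j
    rw [cubeVec_apply]
    split_ifs
    · simp
    · simpa using sq_nonneg δ
  calc ∑ j, ‖cubeVec δ u j‖ ^ 2 ≤ ∑ _j : Fin p, δ ^ 2 := Finset.sum_le_sum fun j _ => h j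
    _ = δ ^ 2 * p := by simp [mul_comm]

theorem norm_cubeVec_update_sub {δ : ℝ} (hδ : 0 ≤ δ) (u : Fin p → Bool) (j : Fin p) :
    ‖cubeVec δ (Function.update u j true) - cubeVec δ (Function.update u j false)‖ = δ := by
  have : cubeVec δ (Function.update u j true) - cubeVec δ (Function.update u j false) =
      EuclideanSpace.single j δ := by
    ext i
    by_cases hi : i = j
    · subst hi
      simp [cubeVec_apply]
    · simp [cubeVec_apply, hi]
  rw [this, PiLp.norm_single, Real.norm_of_nonneg hδ]

theorem mul_sqrt_hammingDist_le {κ : ℝ} (hκ : 0 ≤ κ) {u u' : Fin p → Bool}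
    {x x' : EuclideanSpace ℝ (Fin p)} (h : ∀ j, u j ≠ u' j → κ ≤ |x j - x' j|) :
    κ * √(hammingDist u u' : ℝ) ≤ ‖x - x'‖ := by
  rw [EuclideanSpace.norm_eq]
  apply Real.le_sqrt_of_sq_le
  rw [mul_pow, Real.sq_sqrt (Nat.cast_nonneg _), hammingDist, mul_comm, ← nsmul_eq_mul, ← Finset.sum_const]
  refine (Finset.sum_le_sum fun j hj => ?_).trans
    (Finset.sum_le_univ_sum_of_nonneg fun j => by positivity)
  rw [Real.norm_eq_abs, PiLp.sub_apply]
  have := h j (Finset.mem_filter.1 hj).2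
  gcongr

theorem mul_sqrt_hammingDist_le_cubeVec {δ : ℝ} (hδ : 0 ≤ δ) (u u' : Fin p → Bool) :
    δ * √(hammingDist u u' : ℝ) ≤ ‖cubeVec δ u - cubeVec δ u'‖ := by
  refine mul_sqrt_hammingDist_le hδ fun j hj => ?_
  rw [cubeVec_apply, cubeVec_apply]
  rcases hu : u j with _ | _ <;> rcases hu' : u' j with _ | _ <;> simp_all [le_abs_self]

/-- The hypercube translated along a coordinate axis. -/
noncomputable def spikeVec (i : Fin p) (ρ δ : ℝ) (u : Fin p → Bool) : EuclideanSpace ℝ (Fin p) :=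
  EuclideanSpace.single i ρ + cubeVec δ u

theorem spikeVec_apply (i : Fin p) (ρ δ : ℝ) (u : Fin p → Bool) (j : Fin p) :
    spikeVec i ρ δ u j = (if j = i then ρ else 0) + if u j then δ else 0 := by
  simp [spikeVec, cubeVec_apply]

theorem norm_spikeVec_le (i : Fin p) {ρ δ : ℝ} (hρ : 0 ≤ ρ) (hδ : 0 ≤ δ) (u : Fin p → Bool) :
    ‖spikeVec i ρ δ u‖ ≤ ρ + δ * √p := by
  refine (norm_add_le _ _).trans (add_le_add ?_ (norm_cubeVec_le hδ u))
  rw [PiLp.norm_single, Real.norm_of_nonneg hρ]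

/-- The `i`-th column of `x xᵀ` separates the vertices of the hypercube. -/
theorem mul_sqrt_hammingDist_le_spikeVec (i : Fin p) {ρ δ : ℝ} (hρ : 0 ≤ ρ) (hδ : 0 ≤ δ)
    (u u' : Fin p → Bool) :
    ρ * δ * √(hammingDist u u' : ℝ) ≤
      ‖spikeVec i ρ δ u i • spikeVec i ρ δ u - spikeVec i ρ δ u' i • spikeVec i ρ δ u'‖ := by
  -- The offset gives `x i ≥ ρ` at every vertex, so switching `x j` on changes `x i * x j` by at
  -- least `ρ δ`. Without it the product could stay zero. For `j = i` the change is `(ρ + δ)² - ρ²`.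
  have key : ∀ (u u' : Fin p → Bool) (j : Fin p), u j = true → u' j = false →
      ρ * δ ≤ spikeVec i ρ δ u i * spikeVec i ρ δ u j -
        spikeVec i ρ δ u' i * spikeVec i ρ δ u' j := by
    intro u u' j hu hu'
    simp only [spikeVec_apply, hu, hu']
    by_cases hj : j = i
    · subst hj
      simp only [hu, hu', if_true]
      simp only [Bool.false_eq_true, if_false]
      nlinarith [mul_nonneg hρ hδ]
    · simp only [hj, if_true, if_false, Bool.false_eq_true]
      split_ifs <;> nlinarith [mul_nonneg hρ hδ]
  refine mul_sqrt_hammingDist_le (by positivity) fun j hj => ?_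
  simp only [PiLp.smul_apply, smul_eq_mul]
  rcases hu : u j with _ | _ <;> rcases hu' : u' j with _ | _
  · simp_all
  · rw [abs_sub_comm]
    exact (key u' u j hu' hu).trans (le_abs_self _)
  · exact (key u u' j hu hu').trans (le_abs_self _)
  · simp_all

end Cube

/-! ### Assouad's lemma for the joint law of target and sources. -/

section Transfer

variable {p K n0 : ℕ} {n : Fin K → ℕ} {S : Finset (Fin K)}

theorem isProbabilityMeasure_sourceLaw {θ : {k // k ∈ S} → GMMParam p}
    (h : ∀ k, (θ k).w ∈ Set.Icc (0 : ℝ) 1) (Q : ProbabilityMeasure (OutlierData p n S)) :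
    IsProbabilityMeasure (sourceLaw n S θ Q) := by
  have := fun k => GMMParam.isProbabilityMeasure_law (h k)
  exact Measure.isProbabilityMeasure_map (MeasurableEquiv.measurable _).aemeasurable

theorem isProbabilityMeasure_transferLaw {θ0 : GMMParam p} {θ : {k // k ∈ S} → GMMParam p}
    (h0 : θ0.w ∈ Set.Icc (0 : ℝ) 1) (h : ∀ k, (θ k).w ∈ Set.Icc (0 : ℝ) 1)
    (Q : ProbabilityMeasure (OutlierData p n S)) :
    IsProbabilityMeasure (transferLaw n0 n S θ0 θ Q) := by
  have := GMMParam.isProbabilityMeasure_law h0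
  have := isProbabilityMeasure_sourceLaw h Q
  rw [transferLaw]
  infer_instance

/-- Divergences add over independent observations, and the outlier law, being common to both sides,
contributes zero. -/
theorem renyiTwoLE_transferLaw {θ0 θ0' : GMMParam p} {θ θ' : {k // k ∈ S} → GMMParam p}
    (h0 : θ0.w ∈ Set.Icc (0 : ℝ) 1) (h0' : θ0'.w ∈ Set.Icc (0 : ℝ) 1)
    (h : ∀ k, (θ k).w ∈ Set.Icc (0 : ℝ) 1) (h' : ∀ k, (θ' k).w ∈ Set.Icc (0 : ℝ) 1)
    (Q : ProbabilityMeasure (OutlierData p n S)) {t0 t : ℝ}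
    (hd0 : RenyiTwoLE θ0.law θ0'.law t0) (hd : ∀ k, RenyiTwoLE (θ k).law (θ' k).law t) :
    RenyiTwoLE (transferLaw n0 n S θ0 θ Q) (transferLaw n0 n S θ0' θ' Q)
      (n0 * t0 + (∑ k ∈ S, n k : ℕ) * t) := by
  have := GMMParam.isProbabilityMeasure_law h0
  have := GMMParam.isProbabilityMeasure_law h0'
  have := fun k => GMMParam.isProbabilityMeasure_law (h k)
  have := fun k => GMMParam.isProbabilityMeasure_law (h' k)
  have := isProbabilityMeasure_sourceLaw h Q
  have := isProbabilityMeasure_sourceLaw h' Q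
  have hs : RenyiTwoLE (sourceLaw n S θ Q) (sourceLaw n S θ' Q) ((∑ k ∈ S, n k : ℕ) * t) := by
    have h1 := RenyiTwoLE.pi fun k : {k // k ∈ S} => (hd k).pi_const (n := n k)
    have h2 := (h1.prod (RenyiTwoLE.refl (Q : Measure (OutlierData p n S)))).map
      (MeasurableEquiv.piEquivPiSubtypeProd
        (fun k : Fin K => Fin (n k) → EuclideanSpace ℝ (Fin p)) (fun k => k ∈ S)).symm.measurable
    rw [← Finset.sum_mul, Finset.sum_coe_sort S fun k => (n k : ℝ), add_zero] at h2
    push_cast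
    exact h2
  exact hd0.pi_const.prod hs

/-- Assouad's lemma for the family of joint laws indexed by a hypercube. -/
theorem exists_transferLaw_ge {m : ℕ} (hm : 1 ≤ m) (θ0 : (Fin m → Bool) → GMMParam p)
    (θ : (Fin m → Bool) → {k // k ∈ S} → GMMParam p)
    (h0 : ∀ u, (θ0 u).w ∈ Set.Icc (0 : ℝ) 1) (h : ∀ u k, (θ u k).w ∈ Set.Icc (0 : ℝ) 1)
    (Q : ProbabilityMeasure (OutlierData p n S)) {t0 t κ : ℝ}
    (hd0 : ∀ u j, RenyiTwoLE (θ0 (Function.update u j true)).law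
      (θ0 (Function.update u j false)).law t0)
    (hd : ∀ u j k, RenyiTwoLE (θ (Function.update u j true) k).law
      (θ (Function.update u j false) k).law t)
    (ht : n0 * t0 + (∑ k ∈ S, n k : ℕ) * t ≤ 1 / 5)
    (L : (Fin m → Bool) → TransferData p K n0 n → ℝ) (hL : ∀ u, Measurable (L u)) (hκ : 0 ≤ κ)
    (hsep : ∀ u u' x, κ * √(hammingDist u u' : ℝ) ≤ L u x + L u' x) :
    ∃ u, 1 / 5 ≤ (transferLaw n0 n S (θ0 u) (θ u) Q).real {x | κ / 8 * √m ≤ L u x} := by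
  have := fun u => isProbabilityMeasure_transferLaw (n0 := n0) (h0 u) (h u) Q
  exact assouad hm (fun u => transferLaw n0 n S (θ0 u) (θ u) Q) L hL hκ hsep
    (fun u j => renyiTwoLE_transferLaw (h0 _) (h0 _) (h _) (h _) Q (hd0 u j) (hd u j)) ht

theorem measurable_coefDist_comp {X : Type*} [MeasurableSpace X] {est : X → GMMCoef p}
    (h : Measurable est) (a : GMMCoef p) : Measurable fun x => coefDist (est x) a := by
  unfold coefDist
  fun_prop

theorem abs_w_sub_le_coefDist (x a b : GMMCoef p) :
    |a.1 - b.1| ≤ coefDist x a + coefDist x b := by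
  refine (abs_sub_le _ x.1 _).trans (add_le_add ?_ ?_)
  · rw [abs_sub_comm]
    exact le_max_left _ _
  · exact le_max_left _ _

theorem norm_mu1_sub_le_coefDist (x a b : GMMCoef p) :
    ‖a.2.1 - b.2.1‖ ≤ coefDist x a + coefDist x b := by
  refine (norm_sub_le_norm_sub_add_norm_sub _ x.2.1 _).trans (add_le_add ?_ ?_)
  · rw [norm_sub_rev]
    exact (le_max_left _ _).trans (le_max_right _ _)
  · exact (le_max_left _ _).trans (le_max_right _ _)

theorem norm_beta_sub_le_coefDist (x a b : GMMCoef p) :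
    ‖a.2.2.2 - b.2.2.2‖ ≤ coefDist x a + coefDist x b := by
  have h : ∀ c : GMMCoef p, ‖x.2.2.2 - c.2.2.2‖ ≤ coefDist x c := fun c =>
    (le_max_right _ _).trans ((le_max_right _ _).trans (le_max_right _ _))
  refine (norm_sub_le_norm_sub_add_norm_sub _ x.2.2.2 _).trans (add_le_add ?_ (h b))
  rw [norm_sub_rev]
  exact h a

end Transfer

/-! ### One lower bound for each non-outlier term, and for the covariance. -/

section LowerBounds

open scoped RealInnerProductSpace

variable {p K n0 : ℕ} {n : Fin K → ℕ} {Mμ cw cS hw hμ hβ δ : ℝ}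

theorem half_mem_Ioo (hcw' : cw < 1 / 2) : (1 / 2 : ℝ) ∈ Set.Ioo cw (1 - cw) :=
  ⟨hcw', by linarith⟩

theorem half_mem_Icc : (1 / 2 : ℝ) ∈ Set.Icc (0 : ℝ) 1 := by constructor <;> norm_num

theorem half_mem_unit_Ioo : (1 / 2 : ℝ) ∈ Set.Ioo (0 : ℝ) 1 := by constructor <;> norm_num

/-- Two components at distance `Mμ / 2`, translated by `v`, with identity covariance. -/
noncomputable def shiftedParam (Mμ : ℝ) (i : Fin p) (v : EuclideanSpace ℝ (Fin p)) : GMMParam p :=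
  ⟨1 / 2, EuclideanSpace.single i (Mμ / 2) + v, 0 + v, spikedCov 0⟩

/-- Both means move together, so the target means can vary while the constraint on `β` holds even
with radius zero. -/
theorem beta_shiftedParam (i : Fin p) (v : EuclideanSpace ℝ (Fin p)) :
    (shiftedParam Mμ i v).beta = EuclideanSpace.single i (Mμ / 2) :=
  beta_spikedCov _ _ _ _ _ (by simp)

theorem isGMMParam_shiftedParam (hMμ : 0 < Mμ) (hcw' : cw < 1 / 2) (hcS : 1 < cS) (i : Fin p)
    {v : EuclideanSpace ℝ (Fin p)} (hv : ‖v‖ ≤ Mμ / 2) :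
    IsGMMParam Mμ cw cS (shiftedParam Mμ i v) := by
  refine isGMMParam_spikedCov hcS (half_mem_Ioo hcw') ?_ ?_ (by simpa using hcS.le)
  · refine (norm_add_le _ _).trans ?_
    rw [PiLp.norm_single, Real.norm_of_nonneg (by positivity)]
    linarith
  · rw [zero_add]
    linarith

theorem renyiTwoLE_shiftedParam (i : Fin p) (hδ : 0 ≤ δ) (u : Fin p → Bool) (j : Fin p) :
    RenyiTwoLE (shiftedParam Mμ i (cubeVec δ (Function.update u j true))).law
      (shiftedParam Mμ i (cubeVec δ (Function.update u j false))).law (δ ^ 2) := by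
  have := renyiTwoLE_law_shift half_mem_unit_Ioo (EuclideanSpace.single i (Mμ / 2)) 0
    (cubeVec δ (Function.update u j true)) (cubeVec δ (Function.update u j false))
  rwa [norm_cubeVec_update_sub hδ] at this

variable {S : Finset (Fin K)}

/-- Estimation of a mean that is common to all tasks. -/
theorem exists_transferLaw_ge_of_common_mean (hMμ : 0 < Mμ) (hcw' : cw < 1 / 2) (hcS : 1 < cS)
    (hp : 1 ≤ p) (hw0 : 0 ≤ hw) (hμ0 : 0 ≤ hμ) (hβ0 : 0 ≤ hβ) (hδ : 0 ≤ δ)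
    (hδp : δ * √p ≤ Mμ / 2) (hδn : (((∑ k ∈ S, n k : ℕ) : ℝ) + n0) * δ ^ 2 ≤ 1 / 5)
    (Q : ProbabilityMeasure (OutlierData p n S)) {est : TransferData p K n0 n → GMMCoef p}
    (hest : Measurable est) :
    ∃ (θ0 : GMMParam p) (θ : {k // k ∈ S} → GMMParam p),
      InTransferSpace Mμ cw cS hw hμ hβ θ0 θ ∧
        1 / 5 ≤ (transferLaw n0 n S θ0 θ Q).real {x | δ / 8 * √p ≤ coefDist (est x) θ0.coef} := by
  set i : Fin p := ⟨0, hp⟩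
  have hdiv := renyiTwoLE_shiftedParam (Mμ := Mμ) i hδ
  obtain ⟨u, hu⟩ := exists_transferLaw_ge (n0 := n0) hp (fun u => shiftedParam Mμ i (cubeVec δ u))
    (fun u _ => shiftedParam Mμ i (cubeVec δ u)) (fun _ => half_mem_Icc) (fun _ _ => half_mem_Icc)
    Q hdiv (fun u j _ => hdiv u j) (by linarith)
    (fun u x => coefDist (est x) (shiftedParam Mμ i (cubeVec δ u)).coef)
    (fun u => measurable_coefDist_comp hest _) hδ fun u u' x => by
      refine le_trans ?_ (norm_mu1_sub_le_coefDist _ _ _)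
      simpa [GMMParam.coef, shiftedParam] using mul_sqrt_hammingDist_le_cubeVec hδ u u'
  have hg := isGMMParam_shiftedParam hMμ hcw' hcS i ((norm_cubeVec_le hδ u).trans hδp)
  exact ⟨_, _, ⟨hg, fun _ => ⟨hg, by simpa, by simpa, by simpa⟩⟩, hu⟩

/-- Estimation of a mean of the target, when the sources are not informative. -/
theorem exists_transferLaw_ge_of_target_mean (hMμ : 0 < Mμ) (hcw' : cw < 1 / 2) (hcS : 1 < cS)
    (hp : 1 ≤ p) (hw0 : 0 ≤ hw) (hβ0 : 0 ≤ hβ) (hδ : 0 ≤ δ)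
    (hδp : δ * √p ≤ Mμ / 2) (hδμ : δ * √p ≤ hμ) (hδn : n0 * δ ^ 2 ≤ 1 / 5)
    (Q : ProbabilityMeasure (OutlierData p n S)) {est : TransferData p K n0 n → GMMCoef p}
    (hest : Measurable est) :
    ∃ (θ0 : GMMParam p) (θ : {k // k ∈ S} → GMMParam p),
      InTransferSpace Mμ cw cS hw hμ hβ θ0 θ ∧
        1 / 5 ≤ (transferLaw n0 n S θ0 θ Q).real {x | δ / 8 * √p ≤ coefDist (est x) θ0.coef} := by
  set i : Fin p := ⟨0, hp⟩
  have hdiv := renyiTwoLE_shiftedParam (Mμ := Mμ) i hδ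
  have hprob := GMMParam.isProbabilityMeasure_law (θ := shiftedParam Mμ i 0) half_mem_Icc
  -- The sources stay at the vertex `0`, so only the target sample enters the divergence.
  obtain ⟨u, hu⟩ := exists_transferLaw_ge (n0 := n0) hp (fun u => shiftedParam Mμ i (cubeVec δ u))
    (fun _ _ => shiftedParam Mμ i 0) (fun _ => half_mem_Icc) (fun _ _ => half_mem_Icc)
    Q hdiv (fun u j _ => RenyiTwoLE.refl _) (by linarith)
    (fun u x => coefDist (est x) (shiftedParam Mμ i (cubeVec δ u)).coef)
    (fun u => measurable_coefDist_comp hest _) hδ fun u u' x => by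
      refine le_trans ?_ (norm_mu1_sub_le_coefDist _ _ _)
      simpa [GMMParam.coef, shiftedParam] using mul_sqrt_hammingDist_le_cubeVec hδ u u'
  refine ⟨_, _, ⟨isGMMParam_shiftedParam hMμ hcw' hcS i ((norm_cubeVec_le hδ u).trans hδp),
    fun _ => ⟨isGMMParam_shiftedParam hMμ hcw' hcS i (by simpa using half_pos hMμ |>.le),
      by simpa [shiftedParam],
      ?_, ?_⟩⟩, hu⟩
  · have := (norm_cubeVec_le hδ u).trans hδμ
    simpa [shiftedParam] using this
  · rw [beta_shiftedParam, beta_shiftedParam]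
    simpa

/-- Two components at distance `Mμ / 2`, with proportion `w` and identity covariance. -/
noncomputable def weightParam (Mμ : ℝ) (i : Fin p) (w : ℝ) : GMMParam p :=
  ⟨w, EuclideanSpace.single i (Mμ / 2), 0, spikedCov 0⟩

theorem isGMMParam_weightParam (hMμ : 0 < Mμ) (hcS : 1 < cS) (i : Fin p) {w : ℝ}
    (hw : w ∈ Set.Ioo cw (1 - cw)) : IsGMMParam Mμ cw cS (weightParam Mμ i w) := by
  refine isGMMParam_spikedCov hcS hw ?_ (by simpa using hMμ.le) (by simpa using hcS.le)
  rw [PiLp.norm_single, Real.norm_of_nonneg (by positivity)]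
  linarith

theorem beta_weightParam (i : Fin p) (w : ℝ) :
    (weightParam Mμ i w).beta = EuclideanSpace.single i (Mμ / 2) :=
  beta_spikedCov _ _ _ _ _ (by simp)

theorem renyiTwoLE_weightParam (i : Fin p) {w : ℝ} (hw : w ∈ Set.Icc (0 : ℝ) 1) :
    RenyiTwoLE (weightParam Mμ i w).law (weightParam Mμ i (1 / 2)).law (4 * (w - 1 / 2) ^ 2) :=
  renyiTwoLE_law_of_weight hw _ _ _

/-- The two proportions `1 / 2` and `1 / 2 + δ`. -/
noncomputable def twoWeights (δ : ℝ) (u : Fin 1 → Bool) : ℝ := 1 / 2 + if u 0 then δ else 0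

theorem twoWeights_mem (hcw' : cw < 1 / 2) (hδ : 0 ≤ δ) (hδw : δ < 1 / 2 - cw) (u : Fin 1 → Bool) :
    twoWeights δ u ∈ Set.Ioo cw (1 - cw) := by
  unfold twoWeights
  split_ifs <;> constructor <;> linarith

theorem renyiTwoLE_twoWeights (hcw : 0 < cw) (hcw' : cw < 1 / 2) (hδ : 0 ≤ δ)
    (hδw : δ < 1 / 2 - cw) (i : Fin p) (u : Fin 1 → Bool) (j : Fin 1) :
    RenyiTwoLE (weightParam Mμ i (twoWeights δ (Function.update u j true))).law
      (weightParam Mμ i (twoWeights δ (Function.update u j false))).law (4 * δ ^ 2) := by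
  have hj : j = 0 := Subsingleton.elim _ _
  subst hj
  have h := twoWeights_mem hcw' hδ hδw (Function.update u 0 true)
  have := renyiTwoLE_weightParam (Mμ := Mμ) i (w := twoWeights δ (Function.update u 0 true))
    ⟨by linarith [h.1], by linarith [h.2]⟩
  simpa [twoWeights] using this

theorem mul_sqrt_hammingDist_le_twoWeights (hδ : 0 ≤ δ) (u u' : Fin 1 → Bool) :
    δ * √(hammingDist u u' : ℝ) ≤ |twoWeights δ u - twoWeights δ u'| := by
  unfold twoWeights hammingDist
  rcases hu : u 0 with _ | _ <;> rcases hu' : u' 0 with _ | _ <;>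
    simp [Finset.filter_singleton, Finset.univ_unique, hu, hu', abs_of_nonneg hδ]

/-- Estimation of the proportion of the target, when the sources are not informative. -/
theorem exists_transferLaw_ge_of_target_weight (hMμ : 0 < Mμ) (hcw : 0 < cw) (hcw' : cw < 1 / 2)
    (hcS : 1 < cS) (hp : 1 ≤ p) (hμ0 : 0 ≤ hμ) (hβ0 : 0 ≤ hβ) (hδ : 0 ≤ δ)
    (hδw : δ < 1 / 2 - cw) (hδh : δ ≤ hw) (hδn : n0 * δ ^ 2 ≤ 1 / 20)
    (Q : ProbabilityMeasure (OutlierData p n S)) {est : TransferData p K n0 n → GMMCoef p}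
    (hest : Measurable est) :
    ∃ (θ0 : GMMParam p) (θ : {k // k ∈ S} → GMMParam p),
      InTransferSpace Mμ cw cS hw hμ hβ θ0 θ ∧
        1 / 5 ≤ (transferLaw n0 n S θ0 θ Q).real {x | δ / 8 ≤ coefDist (est x) θ0.coef} := by
  set i : Fin p := ⟨0, hp⟩
  have hprob := GMMParam.isProbabilityMeasure_law (θ := weightParam Mμ i (1 / 2)) half_mem_Icc
  have hmem := fun u => twoWeights_mem hcw' hδ hδw u
  obtain ⟨u, hu⟩ := exists_transferLaw_ge (n0 := n0) le_rfl
    (fun u => weightParam Mμ i (twoWeights δ u)) (fun _ _ => weightParam Mμ i (1 / 2))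
    (fun u => ⟨by linarith [(hmem u).1, show (weightParam Mμ i (twoWeights δ u)).w = twoWeights δ u from rfl],
      by linarith [(hmem u).2, show (weightParam Mμ i (twoWeights δ u)).w = twoWeights δ u from rfl]⟩)
    (fun _ _ => half_mem_Icc) Q (renyiTwoLE_twoWeights hcw hcw' hδ hδw i)
    (fun u j _ => RenyiTwoLE.refl _) (by linarith)
    (fun u x => coefDist (est x) (weightParam Mμ i (twoWeights δ u)).coef)
    (fun u => measurable_coefDist_comp hest _) hδ fun u u' x =>
      (mul_sqrt_hammingDist_le_twoWeights hδ u u').trans (abs_w_sub_le_coefDist (est x)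
        (weightParam Mμ i (twoWeights δ u)).coef (weightParam Mμ i (twoWeights δ u')).coef)
  refine ⟨_, _, ⟨isGMMParam_weightParam hMμ hcS i (hmem u),
    fun _ => ⟨isGMMParam_weightParam hMμ hcS i (half_mem_Ioo hcw'), ?_, by simpa [weightParam],
      ?_⟩⟩, by simpa using hu⟩
  · simp only [weightParam, twoWeights]
    rw [sub_add_cancel_left, abs_neg]
    split_ifs
    · rwa [abs_of_nonneg hδ]
    · rw [abs_zero]
      linarith
  · rw [beta_weightParam, beta_weightParam]
    simpa

/-- Two fixed components at distance `Mμ / 2`, with covariance `(I - y yᵀ)⁻¹`. -/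
noncomputable def tiltedParam (Mμ : ℝ) (i : Fin p) (y : EuclideanSpace ℝ (Fin p)) : GMMParam p :=
  ⟨1 / 2, EuclideanSpace.single i (Mμ / 2), 0, spikedCov (inverseSpike y)⟩

theorem beta_tiltedParam (i : Fin p) {y : EuclideanSpace ℝ (Fin p)} (hy : ‖y‖ ≤ 1 / 2) :
    (tiltedParam Mμ i y).beta =
      EuclideanSpace.single i (Mμ / 2) - (Mμ / 2) • (y i • y) := by
  rw [tiltedParam, beta_inverseSpike _ _ _ _ (by linarith), sub_zero,
    EuclideanSpace.inner_single_right, smul_smul]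
  simp

/-- Estimation of `β` of the target, when the sources are not informative. -/
theorem exists_transferLaw_ge_of_target_beta (hMμ : 0 < Mμ) (hcw' : cw < 1 / 2) (hcS : 1 < cS)
    (hp : 1 ≤ p) (hw0 : 0 ≤ hw) (hμ0 : 0 ≤ hμ) {ρ : ℝ} (hρ : 0 ≤ ρ) (hρ1 : ρ ≤ 1 / 4)
    (hρS : 16 / 3 * ρ ^ 2 ≤ cS - 1) (hδ : 0 ≤ δ)
    (hδρ : δ * √p ≤ ρ) (hδβ : Mμ * (δ * √p) ≤ hβ) (hδ1 : 16 * δ ^ 2 ≤ 1)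
    (hδn : n0 * δ ^ 2 ≤ 1 / 40)
    (Q : ProbabilityMeasure (OutlierData p n S)) {est : TransferData p K n0 n → GMMCoef p}
    (hest : Measurable est) :
    ∃ (θ0 : GMMParam p) (θ : {k // k ∈ S} → GMMParam p),
      InTransferSpace Mμ cw cS hw hμ hβ θ0 θ ∧
        1 / 5 ≤ (transferLaw n0 n S θ0 θ Q).real
          {x | Mμ / 2 * (ρ * δ) / 8 * √p ≤ coefDist (est x) θ0.coef} := by
  set i : Fin p := ⟨0, hp⟩
  have hprob := GMMParam.isProbabilityMeasure_law
    (θ := tiltedParam Mμ i (EuclideanSpace.single i ρ)) half_mem_Icc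
  have hnorm : ∀ u, ‖spikeVec i ρ δ u‖ ≤ 2 * ρ := fun u =>
    (norm_spikeVec_le i hρ hδ u).trans (by linarith)
  have hnorm' : ∀ u, ‖spikeVec i ρ δ u‖ ≤ 1 / 2 := fun u => (hnorm u).trans (by linarith)
  have hsingle : ‖(EuclideanSpace.single i ρ : EuclideanSpace ℝ (Fin p))‖ = ρ := by
    rw [PiLp.norm_single, Real.norm_of_nonneg hρ]
  have hgmm : ∀ y : EuclideanSpace ℝ (Fin p), ‖y‖ ≤ 2 * ρ →
      IsGMMParam Mμ cw cS (tiltedParam Mμ i y) := by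
    intro y hy
    refine isGMMParam_spikedCov hcS (half_mem_Ioo hcw') ?_ (by simpa using hMμ.le) ?_
    · rw [PiLp.norm_single, Real.norm_of_nonneg (by positivity)]
      linarith
    · have h1 := norm_inverseSpike_sq (y := y) (by linarith)
      nlinarith [norm_nonneg y]
  have hdiv : ∀ (u : Fin p → Bool) j,
      RenyiTwoLE (tiltedParam Mμ i (spikeVec i ρ δ (Function.update u j true))).law
        (tiltedParam Mμ i (spikeVec i ρ δ (Function.update u j false))).law (8 * δ ^ 2) := by
    intro u j
    have h1 := norm_inverseSpike_sub_le (hnorm' (Function.update u j true))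
      (hnorm' (Function.update u j false))
    have h2 : spikeVec i ρ δ (Function.update u j true) -
        spikeVec i ρ δ (Function.update u j false) =
        cubeVec δ (Function.update u j true) - cubeVec δ (Function.update u j false) :=
      add_sub_add_left_eq_sub _ _ _
    rw [h2, norm_cubeVec_update_sub hδ] at h1
    -- Neighbouring spikes are at distance at most `2δ`: the divergence is at most `2 (2δ)² = 8 δ²`,
    -- provided that `(2δ)² ≤ 1/4`.
    have h3 := pow_le_pow_left₀ (norm_nonneg _) h1 2
    exact (renyiTwoLE_law_spikedCov half_mem_unit_Ioo (EuclideanSpace.single i (Mμ / 2)) 0 _ _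
      (by linarith)).mono (by linarith)
  obtain ⟨u, hu⟩ := exists_transferLaw_ge (n0 := n0) hp
    (fun u => tiltedParam Mμ i (spikeVec i ρ δ u))
    (fun _ _ => tiltedParam Mμ i (EuclideanSpace.single i ρ)) (fun _ => half_mem_Icc)
    (fun _ _ => half_mem_Icc) Q hdiv (fun u j _ => RenyiTwoLE.refl _) (by linarith)
    (fun u x => coefDist (est x) (tiltedParam Mμ i (spikeVec i ρ δ u)).coef)
    (fun u => measurable_coefDist_comp hest _) (κ := Mμ / 2 * (ρ * δ)) (by positivity)
    fun u u' x => by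
      refine le_trans ?_ (norm_beta_sub_le_coefDist _ _ _)
      simp only [GMMParam.coef]
      rw [beta_tiltedParam i (hnorm' u), beta_tiltedParam i (hnorm' u'), sub_sub_sub_cancel_left,
        ← smul_sub, norm_smul, Real.norm_of_nonneg (by positivity), norm_sub_rev, mul_assoc]
      gcongr
      exact mul_sqrt_hammingDist_le_spikeVec i hρ hδ u u'
  refine ⟨_, _, ⟨hgmm _ (hnorm u),
    fun _ => ⟨hgmm _ (by linarith), by simpa [tiltedParam], by simpa [tiltedParam], ?_⟩⟩, hu⟩
  rw [beta_tiltedParam i (by linarith), beta_tiltedParam i (hnorm' u), sub_sub_sub_cancel_left,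
    ← smul_sub, norm_smul, Real.norm_of_nonneg (by positivity)]
  set y := spikeVec i ρ δ u with hy
  set z : EuclideanSpace ℝ (Fin p) := EuclideanSpace.single i ρ with hz
  have hyz : ‖y - z‖ ≤ δ * √p := by
    rw [hy, spikeVec, add_sub_cancel_left]
    exact norm_cubeVec_le hδ u
  -- The quadratic map `y ↦ y i • y` is Lipschitz on bounded sets, which keeps the target within
  -- `h_β` of the sources.
  have hsub : y i • y - z i • z = y i • (y - z) + (y - z) i • z := by
    simp only [PiLp.sub_apply]
    module
  have h1 : ‖y i • y - z i • z‖ ≤ 2 * (δ * √p) := by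
    rw [hsub]
    refine (norm_add_le _ _).trans ?_
    rw [norm_smul, norm_smul, hsingle]
    have a1 := PiLp.norm_apply_le y i
    have a2 := PiLp.norm_apply_le (y - z) i
    have a3 := hnorm' u
    have := norm_nonneg (y i)
    have := norm_nonneg ((y - z) i)
    have := norm_nonneg (y - z)
    nlinarith
  nlinarith

/-- The `i`-th column of a matrix, as a Euclidean vector. -/
noncomputable def euclideanCol (A : Matrix (Fin p) (Fin p) ℝ) (i : Fin p) :
    EuclideanSpace ℝ (Fin p) :=
  WithLp.toLp 2 fun j => A j i

theorem norm_euclideanCol_le (A : Matrix (Fin p) (Fin p) ℝ) (i : Fin p) :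
    ‖euclideanCol A i‖ ≤ spectralNorm2 A := by
  have h := (Matrix.toEuclideanCLM (n := Fin p) (𝕜 := ℝ) A).le_opNorm (EuclideanSpace.single i 1)
  rw [PiLp.norm_single, norm_one, mul_one] at h
  refine le_trans (le_of_eq ?_) h
  congr 1
  ext j
  simp [euclideanCol]

/-- Estimation of the covariance matrix of the target. -/
theorem exists_transferLaw_ge_of_target_cov (hMμ : 0 < Mμ) (hcw' : cw < 1 / 2) (hcS : 1 < cS)
    (hp : 1 ≤ p) (hw0 : 0 ≤ hw) (hμ0 : 0 ≤ hμ) (hβ0 : 0 ≤ hβ) {ρ : ℝ} (hρ : 0 ≤ ρ)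
    (hρS : 4 * ρ ^ 2 ≤ cS - 1) (hδ : 0 ≤ δ) (hδρ : δ * √p ≤ ρ) (hδ1 : 4 * δ ^ 2 ≤ 1)
    (hδn : n0 * δ ^ 2 ≤ 1 / 10)
    (Q : ProbabilityMeasure (OutlierData p n S))
    {est : TransferData p K n0 n → Matrix (Fin p) (Fin p) ℝ}
    (hest : ∀ i j, Measurable fun x => est x i j) :
    ∃ (θ0 : GMMParam p) (θ : {k // k ∈ S} → GMMParam p),
      InTransferSpace Mμ cw cS hw hμ hβ θ0 θ ∧
        1 / 5 ≤ (transferLaw n0 n S θ0 θ Q).real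
          {x | ρ * δ / 8 * √p ≤ spectralNorm2 (est x - θ0.cov)} := by
  set i : Fin p := ⟨0, hp⟩
  -- With equal means `β` vanishes for every covariance, so the sources may keep the identity
  -- covariance whatever the radii.
  set θc : EuclideanSpace ℝ (Fin p) → GMMParam p := fun v => ⟨1 / 2, 0, 0, spikedCov v⟩ with hθc
  have hnorm : ∀ u, ‖spikeVec i ρ δ u‖ ≤ 2 * ρ := fun u =>
    (norm_spikeVec_le i hρ hδ u).trans (by linarith)
  have hgmm : ∀ v : EuclideanSpace ℝ (Fin p), ‖v‖ ≤ 2 * ρ → IsGMMParam Mμ cw cS (θc v) := by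
    intro v hv
    exact isGMMParam_spikedCov hcS (half_mem_Ioo hcw') (by simpa using hMμ.le)
      (by simpa using hMμ.le) (by nlinarith [norm_nonneg v])
  have hβc : ∀ v, (θc v).beta = 0 := fun v => beta_spikedCov _ _ _ _ _ (by simp)
  have hprob := GMMParam.isProbabilityMeasure_law (θ := θc 0) half_mem_Icc
  have hdiv : ∀ (u : Fin p → Bool) j,
      RenyiTwoLE (θc (spikeVec i ρ δ (Function.update u j true))).law
        (θc (spikeVec i ρ δ (Function.update u j false))).law (2 * δ ^ 2) := by
    intro u j
    have h2 : spikeVec i ρ δ (Function.update u j true) -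
        spikeVec i ρ δ (Function.update u j false) =
        cubeVec δ (Function.update u j true) - cubeVec δ (Function.update u j false) :=
      add_sub_add_left_eq_sub _ _ _
    have h3 := renyiTwoLE_law_spikedCov half_mem_unit_Ioo 0 0
      (spikeVec i ρ δ (Function.update u j true)) (spikeVec i ρ δ (Function.update u j false))
    rw [h2, norm_cubeVec_update_sub hδ] at h3
    exact h3 (by linarith)
  obtain ⟨u, hu⟩ := exists_transferLaw_ge (n0 := n0) hp (fun u => θc (spikeVec i ρ δ u))
    (fun _ _ => θc 0) (fun _ => half_mem_Icc) (fun _ _ => half_mem_Icc) Q hdiv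
    (fun u j _ => RenyiTwoLE.refl _) (by linarith)
    -- One column already separates the vertices. Its norm is measurable in the entries and is
    -- dominated by the spectral norm at the end.
    (fun u x => ‖euclideanCol (est x) i - euclideanCol (θc (spikeVec i ρ δ u)).cov i‖)
    (fun u => by
      have : Measurable fun x => euclideanCol (est x) i := by
        unfold euclideanCol
        exact (WithLp.measurable_toLp 2 _).comp (measurable_pi_lambda _ fun j => hest j i)
      fun_prop) (κ := ρ * δ) (by positivity)
    fun u u' x => by
      refine (mul_sqrt_hammingDist_le_spikeVec i hρ hδ u u').trans ?_
      have h1 : spikeVec i ρ δ u i • spikeVec i ρ δ u -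
          spikeVec i ρ δ u' i • spikeVec i ρ δ u' =
          euclideanCol (θc (spikeVec i ρ δ u)).cov i -
            euclideanCol (θc (spikeVec i ρ δ u')).cov i := by
        ext j
        simp [euclideanCol, hθc, spikedCov, Matrix.vecMulVec_apply, mul_comm]
      rw [h1]
      refine (norm_sub_le_norm_sub_add_norm_sub _ (euclideanCol (est x) i) _).trans ?_
      rw [norm_sub_rev]
  refine ⟨θc (spikeVec i ρ δ u), fun _ => θc 0, ⟨hgmm _ (hnorm u),
    fun _ => ⟨hgmm _ (by simpa using hρ), by simpa [hθc],
    by simpa [hθc], by simpa [hβc]⟩⟩, hu.trans ?_⟩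
  have := isProbabilityMeasure_transferLaw (S := S) (n0 := n0) (n := n)
    (θ0 := θc (spikeVec i ρ δ u)) (θ := fun _ => θc 0) half_mem_Icc (fun _ => half_mem_Icc) Q
  refine measureReal_mono fun x hx => ?_
  have h : ρ * δ / 8 * √p ≤ spectralNorm2 (est x - (θc (spikeVec i ρ δ u)).cov) :=
    le_trans hx (norm_euclideanCol_le (est x - (θc (spikeVec i ρ δ u)).cov) i)
  exact h

end LowerBounds

/-! ### Contamination and random sets of inliers. -/

section Contamination

/-- Two probability measures that are close in total variation become equal after a suitable
contamination. -/
theorem exists_common_contamination {X : Type*} [MeasurableSpace X] (P P' : Measure X)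
    [IsProbabilityMeasure P] [IsProbabilityMeasure P'] {e : ℝ} (he : 0 < e) (he1 : e < 1)
    (h : ∀ A, MeasurableSet A → (1 - e) * (P.real A - P'.real A) ≤ e) :
    ∃ Q Q' : Measure X, IsProbabilityMeasure Q ∧ IsProbabilityMeasure Q' ∧
      ENNReal.ofReal (1 - e) • P + ENNReal.ofReal e • Q =
        ENNReal.ofReal (1 - e) • P' + ENNReal.ofReal e • Q' := by
  set ν := P + P'
  have hP : P ≪ ν := Measure.absolutelyContinuous_of_le (Measure.le_add_right le_rfl)
  have hP' : P' ≪ ν := Measure.absolutelyContinuous_of_le (Measure.le_add_left le_rfl)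
  set f := P.rnDeriv ν
  set f' := P'.rnDeriv ν
  have hf : Measurable f := Measure.measurable_rnDeriv _ _
  have hf' : Measurable f' := Measure.measurable_rnDeriv _ _
  have hfP : ν.withDensity f = P := Measure.withDensity_rnDeriv_eq _ _ hP
  have hfP' : ν.withDensity f' = P' := Measure.withDensity_rnDeriv_eq _ _ hP'
  set D := ν.withDensity (f - f')
  set D' := ν.withDensity (f' - f)
  -- Truncated subtraction makes `D` and `D'` the positive and negative parts of `P - P'`; both sums
  -- have density `max f f'`.
  have hsum : P + D' = P' + D := by
    rw [← hfP, ← hfP', ← withDensity_add_left hf, ← withDensity_add_left hf']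
    congr 1
    ext x
    simp only [Pi.add_apply, Pi.sub_apply]
    rw [add_tsub_eq_max, add_tsub_eq_max, max_comm]
  have hA : MeasurableSet {x | f' x ≤ f x} := measurableSet_le hf' hf
  set A := {x | f' x ≤ f x}
  have hDA : D Set.univ = D A := by
    rw [← measure_add_measure_compl hA]
    have : D Aᶜ = 0 := by
      rw [withDensity_apply _ hA.compl, setLIntegral_eq_zero_iff hA.compl (hf.sub hf')]
      refine ae_of_all _ fun x hx => ?_
      have hx' : ¬ f' x ≤ f x := hx
      exact tsub_eq_zero_of_le (not_le.1 hx').le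
    rw [this, add_zero]
  have hD'A : D' A = 0 := by
    rw [withDensity_apply _ hA, setLIntegral_eq_zero_iff hA (hf'.sub hf)]
    refine ae_of_all _ fun x hx => ?_
    have hx' : f' x ≤ f x := hx
    exact tsub_eq_zero_of_le hx'
  have hPA : P A = P' A + D A := by
    have := congrArg (fun m => m A) hsum
    simpa [Measure.add_apply, hD'A] using this
  have hDreal : D A = ENNReal.ofReal (P.real A - P'.real A) := by
    have hfin : D A ≠ ∞ := by
      intro hinf
      rw [hinf, add_top] at hPA
      exact measure_ne_top P A hPA
    rw [measureReal_def, measureReal_def, hPA, ENNReal.toReal_add (measure_ne_top _ _) hfin,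
      add_sub_cancel_left, ENNReal.ofReal_toReal hfin]
  have hmass : D' Set.univ = D Set.univ := by
    have := congrArg (fun m => m Set.univ) hsum
    simpa [Measure.add_apply] using this
  have he0 : 0 ≤ 1 - e := by linarith
  set a := ENNReal.ofReal ((1 - e) / e)
  have hea : ENNReal.ofReal e * a = ENNReal.ofReal (1 - e) := by
    rw [← ENNReal.ofReal_mul he.le, mul_div_cancel₀ _ he.ne']
  have ham : a * D Set.univ ≤ 1 := by
    rw [hDA, hDreal, ← ENNReal.ofReal_mul (by positivity), ENNReal.ofReal_le_one,
      div_mul_eq_mul_div, div_le_one he]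
    exact h A hA
  -- Since `e * a = 1 - e`, the contamination adds exactly the missing part `D'` or `D`. The
  -- remaining mass goes to the same multiple of `P` on both sides.
  refine ⟨a • D' + (1 - a * D Set.univ) • P, a • D + (1 - a * D Set.univ) • P, ⟨?_⟩, ⟨?_⟩, ?_⟩
  · simp [hmass, add_tsub_cancel_of_le ham]
  · simp [add_tsub_cancel_of_le ham]
  · simp only [smul_add, smul_smul, hea]
    rw [← add_assoc, ← add_assoc, ← smul_add, ← smul_add, hsum]

variable {ι : Type*} [Fintype ι] [DecidableEq ι]

theorem pi_mixture {X : ι → Type*} [∀ i, MeasurableSpace (X i)] (P Q : ∀ i, Measure (X i))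
    [∀ i, IsProbabilityMeasure (P i)] [∀ i, IsProbabilityMeasure (Q i)] (a b : ℝ) :
    Measure.pi (fun i => ENNReal.ofReal a • P i + ENNReal.ofReal b • Q i) =
      ∑ S : Finset ι, (ENNReal.ofReal a ^ S.card * ENNReal.ofReal b ^ Sᶜ.card) •
        Measure.pi (fun i => if i ∈ S then P i else Q i) := by
  have hfin : ∀ i, IsFiniteMeasure (ENNReal.ofReal a • P i + ENNReal.ofReal b • Q i) := by
    intro i
    constructor
    simp
  have hprob : ∀ (S : Finset ι) i, IsProbabilityMeasure (if i ∈ S then P i else Q i) := by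
    intro S i
    split_ifs <;> infer_instance
  refine Measure.pi_eq fun s _ => ?_
  simp only [Measure.finsetSum_apply, Measure.smul_apply, Measure.add_apply, smul_eq_mul,
    Measure.pi_pi]
  rw [Fintype.prod_add]
  refine Finset.sum_congr rfl fun S _ => ?_
  rw [Finset.prod_mul_distrib, Finset.prod_mul_distrib, Finset.prod_const, Finset.prod_const,
    ← Finset.prod_mul_prod_compl S]
  have h1 : ∏ i ∈ S, (if i ∈ S then P i else Q i) (s i) = ∏ i ∈ S, P i (s i) :=
    Finset.prod_congr rfl fun i hi => by rw [if_pos hi]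
  have h2 : ∏ i ∈ Sᶜ, (if i ∈ S then P i else Q i) (s i) = ∏ i ∈ Sᶜ, Q i (s i) :=
    Finset.prod_congr rfl fun i hi => by rw [if_neg (Finset.mem_compl.1 hi)]
  rw [h1, h2]
  ring

/-- The weight of `S` when every index is left out of `S` independently with probability `e`. -/
noncomputable def bernoulliWeight (e : ℝ) (S : Finset ι) : ℝ := (1 - e) ^ S.card * e ^ Sᶜ.card

theorem bernoulliWeight_nonneg {e : ℝ} (he : 0 ≤ e) (he1 : e ≤ 1) (S : Finset ι) :
    0 ≤ bernoulliWeight e S :=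
  mul_nonneg (pow_nonneg (sub_nonneg.2 he1) _) (pow_nonneg he _)

theorem sum_bernoulliWeight (e : ℝ) : ∑ S : Finset ι, bernoulliWeight e S = 1 := by
  have := Fintype.prod_add (fun _ : ι => 1 - e) fun _ => e
  simpa [bernoulliWeight] using this.symm

/-- Linearity of expectation: each index is left out with probability `e`. -/
theorem sum_bernoulliWeight_mul (e : ℝ) (a : ι → ℝ) :
    ∑ S : Finset ι, bernoulliWeight e S * ∑ k ∈ Sᶜ, a k = e * ∑ k, a k := by
  have hk : ∀ k : ι, ∑ S : Finset ι, (if k ∈ Sᶜ then bernoulliWeight e S else 0) = e := by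
    intro k
    -- Replacing `1 - e` by `0` at `k` removes from the expansion exactly the sets that contain `k`.
    have h := Fintype.prod_add (fun i : ι => if i = k then 0 else 1 - e) fun _ => e
    rw [Fintype.prod_eq_mul_prod_compl k] at h
    have hone : ∀ i ∈ ({k} : Finset ι)ᶜ, (if i = k then 0 else 1 - e) + e = 1 := by
      intro i hi
      rw [if_neg (by simpa using hi), sub_add_cancel]
    rw [Finset.prod_congr rfl hone] at h
    simp only [if_true, zero_add, Finset.prod_const_one, mul_one] at h
    refine Eq.trans (Finset.sum_congr rfl fun S _ => ?_) h.symm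
    by_cases hkS : k ∈ S
    · rw [if_neg (by simpa using hkS), Finset.prod_eq_zero hkS (by simp), zero_mul]
    · rw [if_pos (by simpa using hkS), bernoulliWeight,
        Finset.prod_congr rfl (g := fun _ => 1 - e)
          (fun i hi => if_neg fun hik : i = k => hkS (hik ▸ hi))]
      simp
  calc ∑ S : Finset ι, bernoulliWeight e S * ∑ k ∈ Sᶜ, a k
      = ∑ S : Finset ι, ∑ k, a k * (if k ∈ Sᶜ then bernoulliWeight e S else 0) := by
        refine Finset.sum_congr rfl fun S _ => ?_
        rw [Finset.mul_sum, ← Finset.sum_filter_add_sum_filter_not Finset.univ (· ∈ Sᶜ)]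
        rw [Finset.sum_congr rfl (s₁ := Finset.univ.filter (¬ · ∈ Sᶜ)) (g := fun _ => (0 : ℝ))
          (fun k hk => by rw [if_neg (Finset.mem_filter.1 hk).2, mul_zero]),
          Finset.sum_const_zero, add_zero]
        refine Finset.sum_congr (by ext; simp) fun k hk => ?_
        rw [if_pos (Finset.mem_filter.1 hk).2, mul_comm]
    _ = ∑ k, a k * e := by
        rw [Finset.sum_comm]
        refine Finset.sum_congr rfl fun k _ => ?_
        rw [← Finset.mul_sum, hk]
    _ = e * ∑ k, a k := by rw [← Finset.sum_mul, mul_comm]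

/-- A random set of inliers has many elements and carries half of the observations with large
probability. -/
theorem exists_of_sum_bernoulliWeight_ge {K s : ℕ} (hsK : s < K) (n : Fin K → ℕ)
    (g : Finset (Fin K) → ℝ) (hg : ∀ S, g S ≤ 1)
    (h : 1 / 5 ≤ ∑ S, bernoulliWeight (((K : ℝ) - s) / (100 * K)) S * g S) :
    ∃ S : Finset (Fin K), s ≤ S.card ∧ ∑ k, n k ≤ 2 * ∑ k ∈ S, n k ∧ 1 / 10 ≤ g S := by
  set e := ((K : ℝ) - s) / (100 * K) with he
  have hsK' : (s : ℝ) < K := by exact_mod_cast hsK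
  have hs0 : (0 : ℝ) ≤ s := Nat.cast_nonneg s
  have hK : (0 : ℝ) < K := by linarith
  have hd : 0 < (K : ℝ) - s := by linarith
  have he0 : 0 ≤ e := by positivity
  have he1 : e ≤ 1 / 100 := by
    rw [he, div_le_div_iff₀ (by positivity) (by norm_num)]
    linarith
  by_contra! hcon
  set N : ℝ := ∑ k, (n k : ℝ) with hN
  have hw := fun S : Finset (Fin K) => bernoulliWeight_nonneg he0 (by linarith) S
  have hN0 : 0 ≤ N := Finset.sum_nonneg fun k _ => Nat.cast_nonneg _
  -- Markov's inequality in pointwise form: if `S` is too small, or carries too few observations,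
  -- one of the last two terms is at least one. Their means are at most `1/100` and `1/50`, and
  -- `1/10 + 1/100 + 1/50 < 1/5`.
  have hpt : ∀ S : Finset (Fin K), g S ≤
      1 / 10 + (∑ k ∈ Sᶜ, (1 : ℝ)) / (K - s) + 2 / N * ∑ k ∈ Sᶜ, (n k : ℝ) := by
    intro S
    have p1 : 0 ≤ (∑ k ∈ Sᶜ, (1 : ℝ)) / (K - s) := by positivity
    have p2 : 0 ≤ 2 / N * ∑ k ∈ Sᶜ, (n k : ℝ) :=
      mul_nonneg (by positivity) (Finset.sum_nonneg fun k _ => Nat.cast_nonneg _)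
    by_cases hS : s ≤ S.card
    · by_cases hn : ∑ k, n k ≤ 2 * ∑ k ∈ S, n k
      · linarith [hcon S hS hn]
      · have hn' : 2 * ∑ k ∈ S, (n k : ℝ) < N := by
          rw [hN]
          exact_mod_cast not_le.1 hn
        have hsplit : ∑ k ∈ S, (n k : ℝ) + ∑ k ∈ Sᶜ, (n k : ℝ) = N :=
          Finset.sum_add_sum_compl _ _
        have hSn : 0 ≤ ∑ k ∈ S, (n k : ℝ) := Finset.sum_nonneg fun k _ => Nat.cast_nonneg _
        have hNpos : 0 < N := by linarith
        have : 1 ≤ 2 / N * ∑ k ∈ Sᶜ, (n k : ℝ) := by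
          rw [div_mul_eq_mul_div, le_div_iff₀ hNpos]
          linarith
        linarith [hg S]
    · have hc : (S.card : ℝ) + Sᶜ.card = K := by
        exact_mod_cast (Finset.card_add_card_compl S).trans (Fintype.card_fin K)
      have hS' : (S.card : ℝ) < s := by exact_mod_cast not_le.1 hS
      have : 1 ≤ (∑ k ∈ Sᶜ, (1 : ℝ)) / (K - s) := by
        rw [le_div_iff₀ hd, Finset.sum_const, nsmul_eq_mul]
        linarith
      linarith [hg S]
  have hsum : ∑ S, bernoulliWeight e S * g S ≤ ∑ S, (bernoulliWeight e S * (1 / 10) +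
      (bernoulliWeight e S * ∑ k ∈ Sᶜ, (1 : ℝ)) * (1 / (K - s)) +
      (bernoulliWeight e S * ∑ k ∈ Sᶜ, (n k : ℝ)) * (2 / N)) := by
    refine Finset.sum_le_sum fun S _ => ?_
    refine (mul_le_mul_of_nonneg_left (hpt S) (hw S)).trans (le_of_eq ?_)
    ring
  rw [Finset.sum_add_distrib, Finset.sum_add_distrib, ← Finset.sum_mul, ← Finset.sum_mul,
    ← Finset.sum_mul, sum_bernoulliWeight, sum_bernoulliWeight_mul, sum_bernoulliWeight_mul,
    ← hN] at hsum
  have h1 : e * (∑ _k : Fin K, (1 : ℝ)) * (1 / (K - s)) = 1 / 100 := by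
    rw [he]
    simp
    field_simp
  have h2 : e * N * (2 / N) ≤ 1 / 50 := by
    rcases hN0.eq_or_lt with h0 | h0
    · rw [← h0]; norm_num
    · have : e * N * (2 / N) = 2 * e := by field_simp
      linarith
  linarith

end Contamination

/-! ### The lower bound due to outlier sources. -/

section Outliers

variable {p K n0 : ℕ} {n : Fin K → ℕ}

theorem sourceLaw_pi (S : Finset (Fin K)) (θ : GMMParam p) (hθ : θ.w ∈ Set.Icc (0 : ℝ) 1)
    (Q : ∀ k, Measure (Fin (n k) → EuclideanSpace ℝ (Fin p))) [∀ k, IsProbabilityMeasure (Q k)] :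
    sourceLaw n S (fun _ => θ) ⟨Measure.pi fun k => Q k, inferInstance⟩ =
      Measure.pi fun k => if k ∈ S then Measure.pi (fun _ : Fin (n k) => θ.law) else Q k := by
  have := GMMParam.isProbabilityMeasure_law hθ
  set μ : ∀ k, Measure (Fin (n k) → EuclideanSpace ℝ (Fin p)) := fun k =>
    if k ∈ S then Measure.pi (fun _ : Fin (n k) => θ.law) else Q k with hμ
  have hprob : ∀ k, IsProbabilityMeasure (μ k) := by
    intro k
    simp only [hμ]
    split_ifs <;> infer_instance
  have h1 : (Measure.pi fun k : {k : Fin K // k ∈ S} =>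
      Measure.pi fun _ : Fin (n k) => θ.law) = Measure.pi fun k : {k // k ∈ S} => μ k := by
    congr 1
    ext1 k
    simp [hμ, k.2]
  have h2 : (Measure.pi fun k : {k : Fin K // ¬ k ∈ S} => Q k) =
      Measure.pi fun k : {k : Fin K // ¬ k ∈ S} => μ k := by
    congr 1
    ext1 k
    simp [hμ, k.2]
  unfold sourceLaw
  rw [ProbabilityMeasure.coe_mk, h1, h2]
  convert (measurePreserving_piEquivPiSubtypeProd μ (· ∈ S)).symm.map_eq

/-- Independent contamination of every source with probability `e` is a mixture over the set of
uncontaminated sources. -/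
theorem prod_pi_mixture_real (θ : GMMParam p) (hθ : θ.w ∈ Set.Icc (0 : ℝ) 1)
    (Q : ∀ k, Measure (Fin (n k) → EuclideanSpace ℝ (Fin p))) [∀ k, IsProbabilityMeasure (Q k)]
    {e : ℝ} (he : 0 ≤ e) (he1 : e ≤ 1) {A : Set (TransferData p K n0 n)} (hA : MeasurableSet A) :
    ((Measure.pi fun _ : Fin n0 => θ.law).prod (Measure.pi fun k : Fin K =>
        ENNReal.ofReal (1 - e) • Measure.pi (fun _ : Fin (n k) => θ.law) +
          ENNReal.ofReal e • Q k)).real A =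
      ∑ S : Finset (Fin K), bernoulliWeight e S *
        (transferLaw n0 n S θ (fun _ => θ) ⟨Measure.pi fun k => Q k, inferInstance⟩).real A := by
  have := GMMParam.isProbabilityMeasure_law hθ
  have hprob := fun S : Finset (Fin K) => isProbabilityMeasure_transferLaw (S := S) (n0 := n0)
    (n := n) (θ := fun _ => θ) hθ (fun _ => hθ) ⟨Measure.pi fun k => Q k, inferInstance⟩
  have hsrc := fun S : Finset (Fin K) => isProbabilityMeasure_sourceLaw (S := S)
    (n := n) (θ := fun _ => θ) (fun _ => hθ) ⟨Measure.pi fun k => Q k, inferInstance⟩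
  have he1' : 0 ≤ 1 - e := sub_nonneg.2 he1
  have hS : ∀ S : Finset (Fin K), ENNReal.ofReal (1 - e) ^ S.card * ENNReal.ofReal e ^ Sᶜ.card =
      ENNReal.ofReal (bernoulliWeight e S) := by
    intro S
    rw [bernoulliWeight, ENNReal.ofReal_mul (by positivity), ENNReal.ofReal_pow he1',
      ENNReal.ofReal_pow he]
  have hfin : ∀ k, IsFiniteMeasure (ENNReal.ofReal (1 - e) •
      Measure.pi (fun _ : Fin (n k) => θ.law) + ENNReal.ofReal e • Q k) := by
    intro k
    constructor
    simp
  rw [measureReal_def, Measure.prod_apply hA, pi_mixture]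
  simp only [hS, Measure.finsetSum_apply, Measure.smul_apply, smul_eq_mul, ← sourceLaw_pi _ θ hθ]
  rw [lintegral_finsetSum _ fun S _ => (measurable_measure_prodMk_left hA).const_mul _]
  rw [ENNReal.toReal_sum]
  · refine Finset.sum_congr rfl fun S _ => ?_
    rw [lintegral_const_mul _ (measurable_measure_prodMk_left hA), ← Measure.prod_apply hA,
      ENNReal.toReal_mul, ENNReal.toReal_ofReal (bernoulliWeight_nonneg he he1 S)]
    rfl
  · intro S _
    rw [lintegral_const_mul _ (measurable_measure_prodMk_left hA), ← Measure.prod_apply hA]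
    exact ENNReal.mul_ne_top ENNReal.ofReal_ne_top (measure_ne_top _ _)

variable {Mμ cw cS hw hμ hβ δ : ℝ}

/-- Estimation of the common proportion in the presence of outlier sources. -/
theorem exists_transferLaw_ge_of_outliers (hMμ : 0 < Mμ) (hcw : 0 < cw) (hcw' : cw < 1 / 2)
    (hcS : 1 < cS) (hp : 1 ≤ p) (hw0 : 0 ≤ hw) (hμ0 : 0 ≤ hμ) (hβ0 : 0 ≤ hβ) (hδ : 0 ≤ δ)
    (hδw : δ < 1 / 2 - cw) (hδn : n0 * δ ^ 2 ≤ 1 / 20) {s : ℕ} (hsK : s < K)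
    (hδk : ∀ k, 2 * (n k * δ ^ 2) ≤ (((K : ℝ) - s) / (100 * K)) ^ 2)
    {est : TransferData p K n0 n → GMMCoef p} (hest : Measurable est) :
    ∃ S : Finset (Fin K), s ≤ S.card ∧ ∑ k, n k ≤ 2 * ∑ k ∈ S, n k ∧
      ∃ (θ0 : GMMParam p) (θ : {k // k ∈ S} → GMMParam p)
        (Q : ProbabilityMeasure (OutlierData p n S)),
        InTransferSpace Mμ cw cS hw hμ hβ θ0 θ ∧
          1 / 10 ≤ (transferLaw n0 n S θ0 θ Q).real {x | δ / 8 ≤ coefDist (est x) θ0.coef} := by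
  set e := ((K : ℝ) - s) / (100 * K) with he
  have hsK' : (s : ℝ) < K := by exact_mod_cast hsK
  have hs0 : (0 : ℝ) ≤ s := Nat.cast_nonneg s
  have hK : (0 : ℝ) < K := by linarith
  have hd : 0 < (K : ℝ) - s := by linarith
  have he0 : 0 < e := by positivity
  have he1 : e ≤ 1 / 100 := by
    rw [he, div_le_div_iff₀ (by positivity) (by norm_num)]
    linarith
  set i : Fin p := ⟨0, hp⟩
  set θ : (Fin 1 → Bool) → GMMParam p := fun u => weightParam Mμ i (twoWeights δ u)
  have hmem := fun u => twoWeights_mem hcw' hδ hδw u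
  have hθw : ∀ u, (θ u).w ∈ Set.Icc (0 : ℝ) 1 := fun u =>
    ⟨(hcw.trans (hmem u).1).le, (hmem u).2.le.trans (by linarith)⟩
  have hlaw := fun u => GMMParam.isProbabilityMeasure_law (hθw u)
  have hcontam : ∀ k, ∃ Q : Bool → Measure (Fin (n k) → EuclideanSpace ℝ (Fin p)),
      (∀ b, IsProbabilityMeasure (Q b)) ∧ ∀ u u' : Fin 1 → Bool,
        ENNReal.ofReal (1 - e) • Measure.pi (fun _ : Fin (n k) => (θ u).law) +
          ENNReal.ofReal e • Q (u 0) =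
        ENNReal.ofReal (1 - e) • Measure.pi (fun _ : Fin (n k) => (θ u').law) +
          ENNReal.ofReal e • Q (u' 0) := by
    intro k
    have hdiv := renyiTwoLE_twoWeights (Mμ := Mμ) hcw hcw' hδ hδw i (fun _ => true) 0
    have hdiv' := hdiv.pi_const (n := n k)
    set ut : Fin 1 → Bool := Function.update (fun _ => true) 0 true
    set uf : Fin 1 → Bool := Function.update (fun _ => true) 0 false
    obtain ⟨Q, Q', hQ, hQ', heq⟩ := exists_common_contamination
      (Measure.pi fun _ : Fin (n k) => (θ ut).law) (Measure.pi fun _ : Fin (n k) => (θ uf).law)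
      he0 (by linarith) fun A hA => by
        -- With `x = 4 nₖ δ² ≤ 2 e²`, the squared difference of probabilities is at most `(exp x -
        -- 1) / 4 ≤ x / 2 ≤ e²`.
        have h1 := hdiv'.sq_sub_le hA
        set z := (Measure.pi fun _ : Fin (n k) => (θ ut).law).real A -
          (Measure.pi fun _ : Fin (n k) => (θ uf).law).real A
        have h2 : z ^ 2 ≤ (Real.exp (n k * (4 * δ ^ 2)) - 1) / 4 := h1
        have h3 := hδk k
        set x := (n k : ℝ) * (4 * δ ^ 2) with hx
        have hx0 : 0 ≤ x := by positivity
        have hx1 : x ≤ 2 * e ^ 2 := by rw [hx]; linarith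
        have hx2 : x ≤ 1 / 2 := by nlinarith
        have h4 : Real.exp x ≤ 1 + 2 * x := by
          refine (Real.exp_bound_div_one_sub_of_interval hx0 (by linarith)).trans ?_
          rw [div_le_iff₀ (by linarith)]
          nlinarith
        have h5 : z ≤ e := by
          refine le_of_sq_le_sq ?_ he0.le
          linarith
        nlinarith
    have hu : ∀ u : Fin 1 → Bool, u = if u 0 then ut else uf := by
      intro u
      ext j
      have hj : j = 0 := Subsingleton.elim _ _
      subst hj
      rcases h : u 0 with _ | _ <;> simp [ut, uf]
    refine ⟨fun b => if b then Q else Q', fun b => by cases b <;> simpa, fun u u' => ?_⟩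
    rw [hu u, hu u']
    rcases u 0 with _ | _ <;> rcases u' 0 with _ | _ <;> simp [ut, uf] <;>
      first | exact heq | exact heq.symm
  choose Q hQ hQeq using hcontam
  set M : (Fin 1 → Bool) → ∀ k, Measure (Fin (n k) → EuclideanSpace ℝ (Fin p)) := fun u k =>
    ENNReal.ofReal (1 - e) • Measure.pi (fun _ : Fin (n k) => (θ u).law) +
      ENNReal.ofReal e • Q k (u 0) with hM
  have hMprob : ∀ u k, IsProbabilityMeasure (M u k) := by
    intro u k
    constructor
    simp only [hM, Measure.add_apply, Measure.smul_apply, measure_univ, smul_eq_mul, mul_one]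
    rw [← ENNReal.ofReal_add (by linarith) he0.le]
    simp
  have hMeq : ∀ u u', M u = M u' := fun u u' => funext fun k => hQeq k u u'
  -- The contaminated source law is the same for both proportions, so the test rests on the target
  -- sample alone.
  obtain ⟨u, hu⟩ := assouad (κ := δ) (t := 1 / 5) le_rfl
    (fun u => (Measure.pi fun _ : Fin n0 => (θ u).law).prod (Measure.pi (M u)))
    (fun u x => coefDist (est x) (θ u).coef) (fun u => measurable_coefDist_comp hest _) hδ
    (fun u u' x => (mul_sqrt_hammingDist_le_twoWeights hδ u u').trans
      (abs_w_sub_le_coefDist (est x) (θ u).coef (θ u').coef))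
    (fun u j => by
      have h1 := (renyiTwoLE_twoWeights (Mμ := Mμ) hcw hcw' hδ hδw i u j).pi_const (n := n0)
      have h2 := h1.prod (RenyiTwoLE.refl (Measure.pi (M (Function.update u j true))))
      rw [hMeq _ (Function.update u j false)] at h2 ⊢
      exact h2.mono (by linarith)) le_rfl
  rw [Nat.cast_one, Real.sqrt_one, mul_one, prod_pi_mixture_real (θ u) (hθw u) (fun k => Q k (u 0))
    he0.le (by linarith) (measurableSet_le measurable_const (measurable_coefDist_comp hest _))] at hu
  have hprob := fun S : Finset (Fin K) => isProbabilityMeasure_transferLaw (S := S) (n0 := n0)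
    (n := n) (θ := fun _ => θ u) (hθw u) (fun _ => hθw u)
    ⟨Measure.pi fun k => Q k (u 0), inferInstance⟩
  obtain ⟨S, hS, hSn, hge⟩ := exists_of_sum_bernoulliWeight_ge hsK n _
    (fun S => measureReal_le_one) hu
  have hg := isGMMParam_weightParam hMμ hcS i (hmem u)
  exact ⟨S, hS, hSn, θ u, fun _ => θ u, _, ⟨hg, fun _ => ⟨hg, by simpa, by simpa, by simpa⟩⟩, hge⟩

end Outliers

/-! ### Choice of constants and combination of the bounds. -/

section Minimax

theorem one_tenth_le_of_real {X : Type*} [MeasurableSpace X] {μ : Measure X} {A B : Set X}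
    (h : 1 / 10 ≤ μ.real A) (hAB : A ⊆ B) : (1 / 10 : ℝ≥0∞) ≤ μ B := by
  refine le_trans ?_ (measure_mono hAB)
  refine le_trans (le_of_eq ?_) (ENNReal.ofReal_le_of_le_toReal h)
  rw [ENNReal.ofReal_div_of_pos (by norm_num)]
  simp

/-- Only the first term of the rate depends on `S`, and it grows as `S` shrinks; an `S` with half of
the observations costs a constant factor. -/
theorem transferRate_le_two_mul {p K s n0 : ℕ} {n : Fin K → ℕ} {S : Finset (Fin K)}
    {hw hμ hβ : ℝ} (hn0 : 1 ≤ n0) (hs : s ≤ K) (hw0 : 0 ≤ hw) (hμ0 : 0 ≤ hμ) (hβ0 : 0 ≤ hβ)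
    (hS : ∑ k, n k ≤ 2 * ∑ k ∈ S, n k) :
    transferRate p K s n0 n S hw hμ hβ ≤
      2 * transferRate p K s n0 n Finset.univ hw hμ hβ := by
  have hn0' : (1 : ℝ) ≤ n0 := by exact_mod_cast hn0
  have hS' : ((∑ k, n k : ℕ) : ℝ) ≤ 2 * (∑ k ∈ S, n k : ℕ) := by exact_mod_cast hS
  have hε : 0 ≤ outlierRatio K s := by
    have : (s : ℝ) ≤ K := by exact_mod_cast hs
    exact div_nonneg (by linarith) (Nat.cast_nonneg _)
  have h1 : √((p : ℝ) / ((∑ k ∈ S, n k : ℕ) + n0 : ℝ)) ≤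
      2 * √((p : ℝ) / ((∑ k, n k : ℕ) + n0 : ℝ)) := by
    rw [show (2 : ℝ) = √4 by rw [show (4 : ℝ) = 2 ^ 2 by norm_num, Real.sqrt_sq (by norm_num)],
      ← Real.sqrt_mul (by norm_num)]
    apply Real.sqrt_le_sqrt
    rw [← mul_div_assoc, div_le_div_iff₀ (by positivity) (by positivity)]
    have hp : (0 : ℝ) ≤ p := Nat.cast_nonneg p
    have h2 : (0 : ℝ) ≤ (∑ k ∈ S, n k : ℕ) := Nat.cast_nonneg _
    nlinarith
  have h2 : 0 ≤ min (outlierRatio K s / √((Finset.univ.sup n : ℕ) : ℝ)) √(1 / (n0 : ℝ)) := by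
    positivity
  have h3 : 0 ≤ min hw √(1 / (n0 : ℝ)) := by positivity
  have h4 : 0 ≤ min hμ √((p : ℝ) / n0) := by positivity
  have h5 : 0 ≤ min hβ √((p : ℝ) / n0) := by positivity
  unfold transferRate
  linarith

theorem sq_mul_le_of_le_sqrt {a x m : ℝ} (hm : 0 < m) (hx0 : 0 ≤ x) (hx : x ≤ √(1 / m)) :
    m * (a * x) ^ 2 ≤ a ^ 2 := by
  have h1 : x ^ 2 ≤ 1 / m := by
    have := pow_le_pow_left₀ hx0 hx 2
    rwa [Real.sq_sqrt (by positivity)] at this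
  rw [le_div_iff₀ hm] at h1
  nlinarith [sq_nonneg a]

theorem sq_mul_le_of_le_sqrt_div {a x m p : ℝ} (hm : 0 < m) (hp : 0 < p) (hx0 : 0 ≤ x)
    (hx : x ≤ √(p / m)) : m * (a * x / √p) ^ 2 ≤ a ^ 2 := by
  have hsp := Real.sqrt_pos.2 hp
  rw [mul_div_assoc]
  refine sq_mul_le_of_le_sqrt hm (by positivity) ?_
  rw [div_le_iff₀ hsp, ← Real.sqrt_mul (by positivity), one_div_mul_eq_div]
  exact hx

/-- The size `a` of the local perturbations, in terms of the constants of the problem. -/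
structure IsLocalScale (Mμ cw cS c C ρ a : ℝ) : Prop where
  ρ_pos : 0 < ρ
  ρ_le : ρ ≤ 1 / 4
  ρ_le_cS : 4 * ρ ≤ cS - 1
  pos : 0 < a
  le_c : a * (200 * (1 + c)) ≤ 1
  le_Mμ : a ≤ Mμ / 2 * √C
  le_ρ : a ≤ ρ * √C
  Mμ_mul_le : Mμ * a ≤ 1
  lt_cw : a < 1 / 2 - cw

theorem exists_isLocalScale {Mμ cw cS c C : ℝ} (hMμ : 0 < Mμ) (hcw' : cw < 1 / 2) (hcS : 1 < cS)
    (hc : 0 < c) (hC : 0 < C) : ∃ ρ a, IsLocalScale Mμ cw cS c C ρ a := by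
  have hC' := Real.sqrt_pos.2 hC
  set ρ := min (1 / 4) ((cS - 1) / 4)
  have hρ : 0 < ρ := lt_min (by norm_num) (by linarith)
  have hρ2 : ρ ≤ (cS - 1) / 4 := min_le_right _ _
  obtain ⟨a, ha0, ha⟩ := exists_between (show (0 : ℝ) < min (1 / (200 * (1 + c)))
    (min (Mμ / 2 * √C) (min (ρ * √C) (min (1 / Mμ) (1 / 2 - cw)))) by
      have : 0 < 1 / 2 - cw := by linarith
      positivity)
  simp only [lt_min_iff] at ha
  obtain ⟨h1, h2, h3, h4, h5⟩ := ha
  rw [lt_div_iff₀ (by positivity)] at h1 h4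
  exact ⟨ρ, a, hρ, min_le_left _ _, by linarith, ha0, h1.le, h2.le, h3.le, by linarith, h5⟩

namespace IsLocalScale

variable {Mμ cw cS c C ρ a : ℝ} {p K s n0 : ℕ} {n : Fin K → ℕ} {hw hμ hβ : ℝ}

theorem le_small (h : IsLocalScale Mμ cw cS c C ρ a) (hc : 0 < c) : a ≤ 1 / 200 := by
  have := h.le_c
  have := h.pos
  nlinarith

theorem sq_le (h : IsLocalScale Mμ cw cS c C ρ a) : 16 / 3 * ρ ^ 2 ≤ cS - 1 := by
  nlinarith [h.ρ_le, h.ρ_le_cS, h.ρ_pos]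

/-- The assumption `n₀ ≥ C p` bounds `√(p / n₀)`, so perturbations of that order stay inside the
bounded parameter space. -/
theorem sqrt_div_le (hC : 0 < C) (hn0 : 1 ≤ n0) (hCp : C * p ≤ n0) {x : ℝ}
    (hx : a ≤ x * √C) (ha : 0 ≤ a) : a * √((p : ℝ) / n0) ≤ x := by
  have hC' := Real.sqrt_pos.2 hC
  have hn0' : (0 : ℝ) < n0 := by exact_mod_cast hn0
  have h1 : √((p : ℝ) / n0) ≤ 1 / √C := by
    rw [one_div, ← Real.sqrt_inv, ← one_div]
    apply Real.sqrt_le_sqrt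
    rw [div_le_div_iff₀ hn0' hC]
    linarith
  calc a * √((p : ℝ) / n0) ≤ x * √C * (1 / √C) := mul_le_mul hx h1 (Real.sqrt_nonneg _) (ha.trans hx)
    _ = x := by field_simp

/-- The bound `ε < c` gives `K ≤ (1 + c) s`, so `ε = (K - s) / s` is comparable to the contamination
probability `(K - s) / (100 K)`. -/
theorem two_mul_sq_le_of_outlierRatio {x m T : ℝ} (hs1 : 1 ≤ s) (hsK : s < K)
    (hε : outlierRatio K s < c) (ha : 0 < a) (hac : a * (200 * (1 + c)) ≤ 1) (hm : 0 < m)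
    (hx : x ≤ m) (hT : 0 ≤ T) (hTm : T ≤ outlierRatio K s / √m) :
    2 * (x * (a * T) ^ 2) ≤ (((K : ℝ) - s) / (100 * K)) ^ 2 := by
  have hs0 : (0 : ℝ) < s := by exact_mod_cast hs1
  have hK0 : (s : ℝ) < K := by exact_mod_cast hsK
  have hK : (0 : ℝ) < K := hs0.trans hK0
  have h2 : m * T ^ 2 ≤ outlierRatio K s ^ 2 := by
    have := pow_le_pow_left₀ hT hTm 2
    rwa [div_pow, Real.sq_sqrt hm.le, le_div_iff₀ hm, mul_comm] at this
  have h3 : a * 2 * outlierRatio K s ≤ ((K : ℝ) - s) / (100 * K) := by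
    rw [outlierRatio] at hε ⊢
    rw [div_lt_iff₀ hs0] at hε
    have h4 : a * 200 * K ≤ s := by
      have h5 : (K : ℝ) ≤ (1 + c) * s := by linarith
      calc a * 200 * K ≤ a * 200 * ((1 + c) * s) := by gcongr
        _ = a * (200 * (1 + c)) * s := by ring
        _ ≤ 1 * s := by gcongr
        _ = s := one_mul _
    rw [mul_div_assoc', div_le_div_iff₀ hs0 (by linarith)]
    have h6 := mul_le_mul_of_nonneg_left h4 (sub_nonneg.2 hK0.le)
    linarith
  have hε0 : 0 ≤ outlierRatio K s := div_nonneg (by linarith) hs0.le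
  calc 2 * (x * (a * T) ^ 2) = 2 * a ^ 2 * (x * T ^ 2) := by ring
    _ ≤ 2 * a ^ 2 * outlierRatio K s ^ 2 := by
        gcongr
        exact (mul_le_mul_of_nonneg_right hx (sq_nonneg _)).trans h2
    _ ≤ (a * 2 * outlierRatio K s) ^ 2 := by nlinarith [sq_nonneg (a * outlierRatio K s)]
    _ ≤ _ := pow_le_pow_left₀ (by positivity) h3 2

/-- The five lower bounds, combined. All the witnesses have components at distance `Mμ / 2`, so that
every coordinate of the reduced parameter is identifiable. -/
theorem exists_coef_witness (h : IsLocalScale Mμ cw cS c C ρ a) (hMμ : 0 < Mμ) (hcw : 0 < cw)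
    (hcw' : cw < 1 / 2) (hcS : 1 < cS) (hc : 0 < c) (hC : 0 < C) (hp : 1 ≤ p) (hs1 : 1 ≤ s)
    (hsK : s ≤ K) (hn : ∀ k, 1 ≤ n k) (hw0 : 0 ≤ hw) (hμ0 : 0 ≤ hμ) (hβ0 : 0 ≤ hβ)
    (hε : outlierRatio K s < c) (hn0 : 1 ≤ n0) (hCp : C * p ≤ n0) {C₁ : ℝ} (hC₁ : 0 < C₁)
    (hC₁1 : 10 * C₁ ≤ a / 8) (hC₁2 : 10 * C₁ ≤ Mμ / 2 * (ρ * a) / 8)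
    {est : TransferData p K n0 n → GMMCoef p} (hest : Measurable est) :
    ∃ (S : Finset (Fin K)) (_ : s ≤ S.card) (θ0 : GMMParam p) (θ : {k // k ∈ S} → GMMParam p)
      (_ : InTransferSpace Mμ cw cS hw hμ hβ θ0 θ) (Q : ProbabilityMeasure (OutlierData p n S)),
      (1 / 10 : ℝ≥0∞) ≤ transferLaw n0 n S θ0 θ Q
        {x | C₁ * transferRate p K s n0 n S hw hμ hβ ≤ coefDist (est x) θ0.coef} := by
  have ha := h.pos
  have ha2 := h.le_small hc
  have ha1 : a ≤ 1 := by linarith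
  have hasq : a ^ 2 ≤ 1 / 200 := by nlinarith
  have hp' : (0 : ℝ) < p := by exact_mod_cast hp
  have hsp := Real.sqrt_pos.2 hp'
  have hn0' : (1 : ℝ) ≤ n0 := by exact_mod_cast hn0
  have hn0p : (0 : ℝ) < n0 := by linarith
  have hsn0 : √(1 / (n0 : ℝ)) ≤ 1 :=
    Real.sqrt_le_one.2 ((div_le_one hn0p).2 hn0')
  have hε0 : 0 ≤ outlierRatio K s := by
    have : (s : ℝ) ≤ K := by exact_mod_cast hsK
    exact div_nonneg (by linarith) (Nat.cast_nonneg _)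
  have hB1 := sqrt_div_le hC hn0 hCp h.le_Mμ ha.le
  have hB2 := sqrt_div_le hC hn0 hCp h.le_ρ ha.le
  set R := transferRate p K s n0 n Finset.univ hw hμ hβ with hR
  have hRdef := hR
  unfold transferRate at hRdef
  set T1 := √((p : ℝ) / ((∑ k, n k : ℕ) + n0 : ℝ)) with hT1
  set T2 := min (outlierRatio K s / √((Finset.univ.sup n : ℕ) : ℝ)) √(1 / (n0 : ℝ)) with hT2
  set T3 := min hw √(1 / (n0 : ℝ)) with hT3
  set T4 := min hμ √((p : ℝ) / n0) with hT4
  set T5 := min hβ √((p : ℝ) / n0) with hT5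
  have hT1p : 0 < T1 := by positivity
  have hT20 : 0 ≤ T2 := by positivity
  have hT30 : 0 ≤ T3 := by positivity
  have hT40 : 0 ≤ T4 := by positivity
  have hT50 : 0 ≤ T5 := by positivity
  have hcard : s ≤ (Finset.univ : Finset (Fin K)).card := by simpa
  -- There are no outlier sources here: the data space is a single point.
  let Q : ProbabilityMeasure (OutlierData p n Finset.univ) := ⟨Measure.dirac 0, inferInstance⟩
  -- it suffices to exceed a fifth of the rate with `S` the set of all sources
  have conclude : ∀ T : ℝ, R ≤ 5 * T → ∀ b : ℝ, 10 * C₁ ≤ b → 0 ≤ T → ∀ r : ℝ, r = b * T →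
      (∃ (θ0 : GMMParam p) (θ : {k // k ∈ (Finset.univ : Finset (Fin K))} → GMMParam p),
        InTransferSpace Mμ cw cS hw hμ hβ θ0 θ ∧
          1 / 5 ≤ (transferLaw n0 n Finset.univ θ0 θ Q).real {x | r ≤ coefDist (est x) θ0.coef}) →
      ∃ (S : Finset (Fin K)) (_ : s ≤ S.card) (θ0 : GMMParam p) (θ : {k // k ∈ S} → GMMParam p)
        (_ : InTransferSpace Mμ cw cS hw hμ hβ θ0 θ) (Q : ProbabilityMeasure (OutlierData p n S)),
        (1 / 10 : ℝ≥0∞) ≤ transferLaw n0 n S θ0 θ Q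
          {x | C₁ * transferRate p K s n0 n S hw hμ hβ ≤ coefDist (est x) θ0.coef} := by
    rintro T hRT b hb hT r rfl ⟨θ0, θ, hin, hge⟩
    refine ⟨Finset.univ, hcard, θ0, θ, hin, Q, one_tenth_le_of_real (le_trans (by norm_num) hge)
      fun x hx => ?_⟩
    have h1 : C₁ * R ≤ b * T := by
      have h3 := mul_le_mul_of_nonneg_left hRT hC₁.le
      have h4 := mul_le_mul_of_nonneg_right hb hT
      have h5 := mul_nonneg hC₁.le hT
      linarith
    exact h1.trans hx
  -- The outlier case also records `0 < T2`, which forces `s < K` and hence a positive contamination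
  -- probability.
  have hmax : R ≤ 5 * T1 ∨ (R ≤ 5 * T2 ∧ 0 < T2) ∨ R ≤ 5 * T3 ∨ R ≤ 5 * T4 ∨ R ≤ 5 * T5 := by
    by_contra! hcon
    obtain ⟨c1, c2, c3, c4, c5⟩ := hcon
    rcases hT20.eq_or_lt with h0 | h0
    · linarith
    · by_cases h6 : R ≤ 5 * T2
      · exact absurd (c2 h6) (not_le.2 h0)
      · linarith
  rcases hmax with hm | ⟨hm, hT2p⟩ | hm | hm | hm
  · set N : ℝ := ((∑ k, n k : ℕ) + n0 : ℝ) with hN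
    have hNp : 0 < N := by positivity
    have hT1le : T1 ≤ √((p : ℝ) / n0) := by
      apply Real.sqrt_le_sqrt
      gcongr
      have : (0 : ℝ) ≤ (∑ k, n k : ℕ) := Nat.cast_nonneg _
      linarith
    refine conclude T1 hm (a / 8) hC₁1 hT1p.le _ ?_
      (exists_transferLaw_ge_of_common_mean (δ := a * T1 / √p) hMμ hcw' hcS hp hw0 hμ0 hβ0
        (by positivity) ?_ ?_ Q hest)
    · field_simp
    · rw [div_mul_cancel₀ _ hsp.ne']
      exact (mul_le_mul_of_nonneg_left hT1le ha.le).trans hB1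
    · have := sq_mul_le_of_le_sqrt_div (a := a) hNp hp' hT1p.le le_rfl
      linarith
  · have hsK' : s < K := by
      by_contra! hKs
      have : s = K := le_antisymm hsK hKs
      have h1 : T2 ≤ 0 := by
        refine (min_le_left _ _).trans ?_
        rw [outlierRatio, this]
        simp
      linarith
    have hT2n0 : T2 ≤ √(1 / (n0 : ℝ)) := min_le_right _ _
    obtain ⟨S, hS, hSn, θ0, θ, Q', hin, hge⟩ := exists_transferLaw_ge_of_outliers
      (δ := a * T2) hMμ hcw hcw' hcS hp hw0 hμ0 hβ0 (by positivity)
      ((mul_le_of_le_one_right ha.le (hT2n0.trans hsn0)).trans_lt h.lt_cw) (by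
        have := sq_mul_le_of_le_sqrt (a := a) hn0p hT20 hT2n0
        linarith) hsK' (fun k => by
        have hk : (n k : ℝ) ≤ (Finset.univ.sup n : ℕ) := by
          exact_mod_cast Finset.le_sup (Finset.mem_univ k)
        have hk1 : (1 : ℝ) ≤ n k := by exact_mod_cast hn k
        set m : ℝ := ((Finset.univ.sup n : ℕ) : ℝ)
        have hm0 : 0 < m := by linarith
        have h1 : T2 ≤ outlierRatio K s / √m := min_le_left _ _
        exact two_mul_sq_le_of_outlierRatio hs1 hsK' hε ha h.le_c hm0 hk
          hT20 h1)
      hest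
    refine ⟨S, hS, θ0, θ, hin, Q', one_tenth_le_of_real hge fun x hx => ?_⟩
    have h1 := transferRate_le_two_mul (p := p) (s := s) hn0 hsK hw0 hμ0 hβ0 hSn
    have h2 : C₁ * transferRate p K s n0 n S hw hμ hβ ≤ a * T2 / 8 := by
      have h3 := mul_le_mul_of_nonneg_left h1 hC₁.le
      have h4 := mul_le_mul_of_nonneg_left hm hC₁.le
      have h5 := mul_le_mul_of_nonneg_right hC₁1 hT20
      linarith
    exact h2.trans hx
  · have hT3n0 : T3 ≤ √(1 / (n0 : ℝ)) := min_le_right _ _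
    have hT3w : T3 ≤ hw := min_le_left _ _
    refine conclude T3 hm (a / 8) hC₁1 hT30 _ ?_
      (exists_transferLaw_ge_of_target_weight (δ := a * T3) hMμ hcw hcw' hcS hp hμ0 hβ0
        (by positivity) ((mul_le_of_le_one_right ha.le (hT3n0.trans hsn0)).trans_lt h.lt_cw)
        ((mul_le_of_le_one_left hT30 ha1).trans hT3w) ?_ Q hest)
    · ring
    · have := sq_mul_le_of_le_sqrt (a := a) hn0p hT30 hT3n0
      linarith
  · have hT4n0 : T4 ≤ √((p : ℝ) / n0) := min_le_right _ _
    have hT4μ : T4 ≤ hμ := min_le_left _ _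
    refine conclude T4 hm (a / 8) hC₁1 hT40 _ ?_
      (exists_transferLaw_ge_of_target_mean (δ := a * T4 / √p) hMμ hcw' hcS hp hw0 hβ0
        (by positivity) ?_ ?_ ?_ Q hest)
    · field_simp
    · rw [div_mul_cancel₀ _ hsp.ne']
      exact (mul_le_mul_of_nonneg_left hT4n0 ha.le).trans hB1
    · rw [div_mul_cancel₀ _ hsp.ne']
      exact (mul_le_of_le_one_left hT40 ha1).trans hT4μ
    · have := sq_mul_le_of_le_sqrt_div (a := a) hn0p hp' hT40 hT4n0
      linarith
  · have hT5n0 : T5 ≤ √((p : ℝ) / n0) := min_le_right _ _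
    have hT5β : T5 ≤ hβ := min_le_left _ _
    have hsq := sq_mul_le_of_le_sqrt_div (a := a) hn0p hp' hT50 hT5n0
    have hρ := h.ρ_pos
    refine conclude T5 hm (Mμ / 2 * (ρ * a) / 8) hC₁2 hT50 _ ?_
      (exists_transferLaw_ge_of_target_beta (δ := a * T5 / √p) hMμ hcw' hcS hp hw0 hμ0 hρ.le
        h.ρ_le h.sq_le (by positivity) ?_ ?_ ?_ ?_ Q hest)
    · field_simp
    · rw [div_mul_cancel₀ _ hsp.ne']
      exact (mul_le_mul_of_nonneg_left hT5n0 ha.le).trans hB2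
    · rw [div_mul_cancel₀ _ hsp.ne', ← mul_assoc]
      exact (mul_le_of_le_one_left hT50 h.Mμ_mul_le).trans hT5β
    · linarith [le_mul_of_one_le_left (sq_nonneg (a * T5 / √p)) hn0']
    · linarith

theorem exists_cov_witness (h : IsLocalScale Mμ cw cS c C ρ a) (hMμ : 0 < Mμ)
    (hcw' : cw < 1 / 2) (hcS : 1 < cS) (hc : 0 < c) (hC : 0 < C) (hp : 1 ≤ p)
    (hsK : s ≤ K) (hw0 : 0 ≤ hw) (hμ0 : 0 ≤ hμ) (hβ0 : 0 ≤ hβ)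
    (hn0 : 1 ≤ n0) (hCp : C * p ≤ n0) {C₁ : ℝ} (hC₁ : C₁ ≤ ρ * a / 8)
    {est : TransferData p K n0 n → Matrix (Fin p) (Fin p) ℝ}
    (hest : ∀ i j, Measurable fun x => est x i j) :
    ∃ (S : Finset (Fin K)) (_ : s ≤ S.card) (θ0 : GMMParam p) (θ : {k // k ∈ S} → GMMParam p)
      (_ : InTransferSpace Mμ cw cS hw hμ hβ θ0 θ) (Q : ProbabilityMeasure (OutlierData p n S)),
      (1 / 10 : ℝ≥0∞) ≤ transferLaw n0 n S θ0 θ Q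
        {x | C₁ * √((p : ℝ) / n0) ≤ spectralNorm2 (est x - θ0.cov)} := by
  have ha := h.pos
  have ha2 := h.le_small hc
  have hasq : a ^ 2 ≤ 1 / 200 := by nlinarith
  have hp' : (0 : ℝ) < p := by exact_mod_cast hp
  have hsp := Real.sqrt_pos.2 hp'
  have hn0' : (1 : ℝ) ≤ n0 := by exact_mod_cast hn0
  have hn0p : (0 : ℝ) < n0 := by linarith
  have hB2 := sqrt_div_le hC hn0 hCp h.le_ρ ha.le
  set T := √((p : ℝ) / n0)
  have hT0 : 0 ≤ T := Real.sqrt_nonneg _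
  have hsq := sq_mul_le_of_le_sqrt_div (a := a) hn0p hp' hT0 le_rfl
  have hρ := h.ρ_pos
  obtain ⟨θ0, θ, hin, hge⟩ := exists_transferLaw_ge_of_target_cov (n0 := n0) (n := n)
    (S := Finset.univ) (δ := a * T / √p) hMμ hcw' hcS hp hw0 hμ0 hβ0 hρ.le
    (by linarith [h.sq_le, sq_nonneg ρ]) (by positivity)
    (by rwa [div_mul_cancel₀ _ hsp.ne'])
    (by linarith [le_mul_of_one_le_left (sq_nonneg (a * T / √p)) hn0'])
    (by linarith) ⟨Measure.dirac 0, inferInstance⟩ hest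
  refine ⟨Finset.univ, by simpa, θ0, θ, hin, _,
    one_tenth_le_of_real (le_trans (by norm_num) hge) fun x hx => ?_⟩
  have h1 : C₁ * T ≤ ρ * (a * T / √p) / 8 * √p := by
    have : ρ * (a * T / √p) / 8 * √p = ρ * a / 8 * T := by field_simp
    rw [this]
    gcongr
  exact h1.trans hx

end IsLocalScale

end Minimax

theorem theorem8 (Mμ cw cS c C : ℝ) (hMμ : 0 < Mμ) (hcw : 0 < cw) (hcw' : cw < 1 / 2)
    (hcS : 1 < cS) (hc : 0 < c) (hC : 0 < C) :
    ∃ C₁ : ℝ, 0 < C₁ ∧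
      ∀ (p K s n0 : ℕ) (n : Fin K → ℕ) (hw hμ hβ : ℝ),
        1 ≤ p → 1 ≤ s → s ≤ K → (∀ k, 1 ≤ n k) → 0 ≤ hw → 0 ≤ hμ → 0 ≤ hβ →
        outlierRatio K s < c → C * p ≤ n0 →
        ((1 / 10 : ℝ≥0∞) ≤
          ⨅ (est : TransferData p K n0 n → GMMCoef p) (_ : Measurable est),
            ⨆ (S : Finset (Fin K)) (_ : s ≤ S.card)
              (θ0 : GMMParam p) (θ : {k // k ∈ S} → GMMParam p)
              (_ : InTransferSpace Mμ cw cS hw hμ hβ θ0 θ)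
              (Q : ProbabilityMeasure (OutlierData p n S)),
              transferLaw n0 n S θ0 θ Q
                {x | C₁ * transferRate p K s n0 n S hw hμ hβ ≤ coefDist (est x) θ0.coef}) ∧
        ((1 / 10 : ℝ≥0∞) ≤
          ⨅ (est : TransferData p K n0 n → Matrix (Fin p) (Fin p) ℝ)
            (_ : ∀ i j, Measurable fun x => est x i j),
            ⨆ (S : Finset (Fin K)) (_ : s ≤ S.card)
              (θ0 : GMMParam p) (θ : {k // k ∈ S} → GMMParam p)
              (_ : InTransferSpace Mμ cw cS hw hμ hβ θ0 θ)
              (Q : ProbabilityMeasure (OutlierData p n S)),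
              transferLaw n0 n S θ0 θ Q
                {x | C₁ * √((p : ℝ) / n0) ≤ spectralNorm2 (est x - θ0.cov)}) := by
  obtain ⟨ρ, a, h⟩ := exists_isLocalScale hMμ hcw' hcS hc hC
  have ha := h.pos
  have hρ := h.ρ_pos
  -- The three entries are the separations for means and proportions, for `β`, and for the
  -- covariance. The factor `10` is `5` for the number of terms times `2` for the random inlier set.
  set C₁ := min (a / 8) (min (Mμ / 2 * (ρ * a) / 8) (ρ * a / 8)) / 10 with hC₁
  have hC₁0 : 0 < C₁ := by positivity
  have e1 : 10 * C₁ ≤ a / 8 := by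
    rw [hC₁, mul_div_cancel₀ _ (by norm_num)]
    exact min_le_left _ _
  have e2 : 10 * C₁ ≤ Mμ / 2 * (ρ * a) / 8 := by
    rw [hC₁, mul_div_cancel₀ _ (by norm_num)]
    exact (min_le_right _ _).trans (min_le_left _ _)
  have e3 : 10 * C₁ ≤ ρ * a / 8 := by
    rw [hC₁, mul_div_cancel₀ _ (by norm_num)]
    exact (min_le_right _ _).trans (min_le_right _ _)
  refine ⟨C₁, hC₁0, fun p K s n0 n hw hμ hβ hp hs1 hsK hn hw0 hμ0 hβ0 hε hCp => ?_⟩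
  have hn0 : 1 ≤ n0 := by
    have hp' : (0 : ℝ) < p := by exact_mod_cast hp
    have : (0 : ℝ) < n0 := lt_of_lt_of_le (by positivity) hCp
    exact_mod_cast this
  constructor
  · refine le_iInf₂ fun est hest => ?_
    obtain ⟨S, hS, θ0, θ, hin, Q, hge⟩ := h.exists_coef_witness hMμ hcw hcw' hcS hc hC hp hs1 hsK hn
      hw0 hμ0 hβ0 hε hn0 hCp hC₁0 e1 e2 hest
    exact hge.trans (le_iSup₂_of_le S hS (le_iSup₂_of_le θ0 θ (le_iSup₂_of_le hin Q le_rfl)))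
  · refine le_iInf₂ fun est hest => ?_
    obtain ⟨S, hS, θ0, θ, hin, Q, hge⟩ := h.exists_cov_witness hMμ hcw' hcS hc hC hp hsK
      hw0 hμ0 hβ0 hn0 hCp (C₁ := C₁) (by linarith) hest
    exact hge.trans (le_iSup₂_of_le S hS (le_iSup₂_of_le θ0 θ (le_iSup₂_of_le hin Q le_rfl)))
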